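/- A spectrally negative Lévy process $X$ (a real Lévy process with $X_0=0$ a.s., càdlàg paths and Lévy–Khintchine triplet $(\mu,\sigma,\Pi)$ with $\Pi(0,\infty)=0$; processes with monotone paths are excluded) has Laplace exponent $\psi$ given by $E(e^{\lambda X_t})=e^{\psi(\lambda)t}$, $\lambda,t\ge 0$. Write $\Phi(0)$ for the largest root of $\psi$ in $[0,\infty)$. The scale function of $X$ is the unique function $W:\mathbb R\to[0,\infty)$ that vanishes on $(-\infty,0)$, is right-continuous on $[0,\infty)$ and satisfies $\int_0^\infty e^{-\beta x}W(x)\,dx=1/\psi(\beta)$ for all $\beta>\Phi(0)$. It is called *complete* if the function $\phi$ in the Wiener–Hopf factorization $\psi(\theta)=(\theta-\Phi(0))\phi(\theta)$ is a complete Bernstein function, that is, $\phi(\theta)=\theta^2\int_0^\infty e^{-\theta x}\eta(x)\,dx$ for $\theta>0$ and some Bernstein function $\eta$ (a function of the form $\eta(\theta)=\kappa+\delta\theta+\int_{(0,\infty)}(1-e^{-\theta x})\,\Upsilon(dx)$, $\theta\ge 0$, with $\kappa,\delta\ge 0$ and $\int_{(0,\infty)}(1\wedge x)\,\Upsilon(dx)<\infty$).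 **Theorem.** Let $W$ be a complete scale function belonging to a spectrally negative Lévy process $X$ with paths of unbounded variation, whose Laplace exponent $\psi$ satisfies $\psi'(0+)=0$. Then there is a spectrally negative Lévy process $X^{\rm s}$ with Laplace exponent $$\psi^{\rm s}(\theta)=\frac{\theta\,\psi(\theta)}{\theta+\psi(\theta)},\quad \theta>0,\qquad \psi^{\rm s}(0)=0,$$ and its scale function is the function equal to $1+W(x)$ for $x\ge 0$ and to $0$ for $x<0$. Moreover, $(X_t+t)_{t\ge 0}$ is a spectrally negative Lévy process with Laplace exponent $\psi(\theta)+\theta$ and it has a scale function $\widetilde W$; and every spectrally negative Lévy process with Laplace exponent $\psi^{\rm s}$ has almost surely paths of bounded variation on compact time intervals, and its jump measure $\Pi^{\rm s}$ satisfies, for every $x>0$, that $\widetilde W$ is differentiable at $x$ and $$\Pi^{\rm s}(-\infty,-x)=\widetilde W'(x)<\infty .$$ -/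

import Mathlib

open MeasureTheory ProbabilityTheory Filter Topology Set
open scoped NNReal ENNReal

noncomputable section

/-- A path indexed by `[0, ∞)` is càdlàg: right continuous with left limits
(the condition on left limits is empty at time `0`). -/
def IsCadlagPath (f : ℝ≥0 → ℝ) : Prop :=
  ∀ t, ContinuousWithinAt f (Ici t) t ∧ ∃ l, Tendsto f (𝓝[<] t) (𝓝 l)

/-- Real-valued Lévy processes. -/
structure IsLevyProcess {Ω : Type*} [MeasurableSpace Ω] (X : ℝ≥0 → Ω → ℝ) (P : Measure Ω) :
    Prop where
  isProbabilityMeasure : IsProbabilityMeasure P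
  measurable : ∀ t, Measurable (X t)
  cadlag : ∀ ω, IsCadlagPath (fun t => X t ω)
  start_zero : ∀ᵐ ω ∂P, X 0 ω = 0
  indep_increments : HasIndepIncrements X P
  stationary_increments : ∀ s t : ℝ≥0, s ≤ t →
    P.map (fun ω => X t ω - X s ω) = P.map (X (t - s))

/-- The characteristic exponent
`Ψ(θ) = iμθ + σ²θ²/2 + ∫ (1 - e^{iθx} + iθx 1_{|x|<1}) ν(dx)`. -/
def levyKhintchineExponent (μ σ : ℝ) (ν : Measure ℝ) (θ : ℝ) : ℂ :=
  Complex.I * μ * θ + (σ : ℂ) ^ 2 / 2 * (θ : ℂ) ^ 2 +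
    ∫ x : ℝ, (1 - Complex.exp (Complex.I * θ * x) +
      Complex.I * θ * (if |x| < 1 then (x : ℂ) else 0)) ∂ν

/-- `(μ, σ, ν)` is a Lévy triplet of the process `X`; `ν` is its jump (Lévy) measure. -/
structure HasLevyTriplet {Ω : Type*} [MeasurableSpace Ω] (X : ℝ≥0 → Ω → ℝ) (P : Measure Ω)
    (μ σ : ℝ) (ν : Measure ℝ) : Prop where
  no_mass_zero : ν {0} = 0
  lintegral_lt_top : ∫⁻ x, ENNReal.ofReal (min 1 (x ^ 2)) ∂ν < ∞
  exponent : ∀ (t : ℝ≥0) (θ : ℝ), ∫ ω, Complex.exp (Complex.I * θ * X t ω) ∂P =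
    Complex.exp (-(t : ℂ) * levyKhintchineExponent μ σ ν θ)

/-- Spectrally negative Lévy processes: no positive jumps, processes with monotone paths being
excluded. -/
structure IsSpectrallyNegativeLevy {Ω : Type*} [MeasurableSpace Ω] (X : ℝ≥0 → Ω → ℝ)
    (P : Measure Ω) : Prop where
  isLevyProcess : IsLevyProcess X P
  jumps_neg : ∃ (μ σ : ℝ) (ν : Measure ℝ), HasLevyTriplet X P μ σ ν ∧ ν (Ioi 0) = 0
  not_monotone : ¬ ∀ᵐ ω ∂P, Monotone (fun t => X t ω)
  not_antitone : ¬ ∀ᵐ ω ∂P, Antitone (fun t => X t ω)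

/-- `ψ` is the Laplace exponent of `X`: `E[e^{λ X_t}] = e^{ψ(λ) t}` for all `λ ≥ 0`. Only the
values of `ψ` on `[0, ∞)` are relevant. -/
def HasLaplaceExponent {Ω : Type*} [MeasurableSpace Ω] (X : ℝ≥0 → Ω → ℝ) (P : Measure Ω)
    (ψ : ℝ → ℝ) : Prop :=
  ∀ (t : ℝ≥0) (l : ℝ), 0 ≤ l → Integrable (fun ω => Real.exp (l * X t ω)) P ∧
    ∫ ω, Real.exp (l * X t ω) ∂P = Real.exp (ψ l * t)

/-- Almost every path has bounded variation on every compact time interval. -/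
def HasBoundedVariationPaths {Ω : Type*} [MeasurableSpace Ω] (X : ℝ≥0 → Ω → ℝ)
    (P : Measure Ω) : Prop :=
  ∀ᵐ ω ∂P, LocallyBoundedVariationOn (fun t => X t ω) univ

/-- `Φ(0)`, the largest root of `ψ(λ) = 0` in `[0, ∞)`. -/
def largestRoot (ψ : ℝ → ℝ) : ℝ := sSup {l : ℝ | 0 ≤ l ∧ ψ l = 0}

/-- `W` is the scale function of the spectrally negative Lévy process with Laplace
exponent `ψ`. -/
structure IsScaleFunction (ψ W : ℝ → ℝ) : Prop where
  nonneg : ∀ x, 0 ≤ W x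
  eq_zero_of_neg : ∀ x, x < 0 → W x = 0
  right_continuous : ∀ x, 0 ≤ x → ContinuousWithinAt W (Ici x) x
  laplace : ∀ β, largestRoot ψ < β →
    IntegrableOn (fun x => Real.exp (-β * x) * W x) (Ioi 0) ∧
      ∫ x in Ioi 0, Real.exp (-β * x) * W x = 1 / ψ β

/-- Bernstein functions `φ(θ) = κ + δθ + ∫_{(0,∞)} (1 - e^{-θx}) Υ(dx)`, `θ ≥ 0`. -/
def IsBernstein (φ : ℝ → ℝ) : Prop :=
  ∃ (κ δ : ℝ) (U : Measure ℝ), 0 ≤ κ ∧ 0 ≤ δ ∧ U (Iic 0) = 0 ∧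
    ∫⁻ x, ENNReal.ofReal (min 1 x) ∂U < ∞ ∧
    ∀ θ, 0 ≤ θ → φ θ = κ + δ * θ + ∫ x, (1 - Real.exp (-θ * x)) ∂U

/-- Complete Bernstein functions `φ(θ) = θ² ∫_{(0,∞)} e^{-θx} η(x) dx` with `η` Bernstein. The
formula is meaningful for `θ > 0`; the value at `0` is the limit there and is not constrained. -/
def IsCompleteBernstein (φ : ℝ → ℝ) : Prop :=
  ∃ η : ℝ → ℝ, IsBernstein η ∧
    ∀ θ, 0 < θ → φ θ = θ ^ 2 * ∫ x in Ioi 0, Real.exp (-θ * x) * η x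

/-- `W` is a complete scale function with parent exponent `ψ`: it is the scale function for `ψ`,
and the Laplace exponent `φ` of the descending ladder height process of the parent process, given
by the Wiener-Hopf factorization `ψ(θ) = (θ - Φ(0)) φ(θ)`, is a complete Bernstein function. -/
def IsCompleteScaleFunction (ψ W : ℝ → ℝ) : Prop :=
  IsScaleFunction ψ W ∧ ∃ φ : ℝ → ℝ, IsCompleteBernstein φ ∧
    ∀ θ, 0 < θ → ψ θ = (θ - largestRoot ψ) * φ θ

/-- The function equal to `1 + W` on `[0, ∞)` and to `0` on `(-∞, 0)`. -/
def shiftedScale (W : ℝ → ℝ) : ℝ → ℝ := (Ici (0 : ℝ)).indicator (fun x => 1 + W x)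

/-- The exponent `ψˢ(θ) = θψ(θ) / (θ + ψ(θ))` (equal to `0` at `θ = 0`). -/
def shiftedExponent (ψ : ℝ → ℝ) : ℝ → ℝ := fun θ => θ * ψ θ / (θ + ψ θ)

end

/-!
Since `ψ'(0+) = 0`, the largest root of `ψ` is `0` and `ψ(θ) = θ φ(θ)` with `φ` complete Bernstein.
Then `θ / (ψ(θ) + θ) = 1 / (1 + φ(θ))` is a Stieltjes function; it is bounded, and its infimum is
`0` because the paths have unbounded variation, so it is the Laplace transform of a continuous
decreasing function `u` vanishing at infinity. The identity `ψˢ(θ) = θ - θ · θ / (ψ(θ) + θ)` then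
exhibits `ψˢ` as the exponent of a unit drift minus a subordinator whose Lévy measure has tail `u`,
while the primitive of `u` has Laplace transform `1 / (ψ(θ) + θ)` and is therefore the scale
function of `X_t + t`.

That reciprocals of complete Bernstein functions are Stieltjes is proved by discretizing the Lévy
measure, where the reciprocal is a diagonal matrix coefficient of the resolvent of a positive
matrix. The subordinator is a sum over the points of independent Poisson configurations on the unit
cells of the plane.
-/

section LaplaceUniqueness

theorem continuous_integral_continuousMap {X : Type*} [TopologicalSpace X] [CompactSpace X]
    [MeasurableSpace X] [OpensMeasurableSpace X] [TopologicalSpace.PseudoMetrizableSpace X]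
    (μ : Measure X) [IsFiniteMeasure μ] : Continuous fun f : C(X, ℝ) => ∫ x, f x ∂μ := by
  have hint (f : C(X, ℝ)) : Integrable f μ :=
    f.continuous.integrable_of_hasCompactSupport (HasCompactSupport.of_compactSpace f)
  refine LipschitzWith.continuous (K := ⟨μ.real univ, measureReal_nonneg⟩)
    (LipschitzWith.of_dist_le_mul fun f g => ?_)
  rw [dist_eq_norm, ← integral_sub (hint f) (hint g), mul_comm]
  exact norm_integral_le_of_norm_le_const
    (ae_of_all _ fun x => dist_eq_norm (f x) (g x) ▸ ContinuousMap.dist_apply_le_dist x)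

theorem ext_of_forall_integral_pow_unitInterval {μ ν : Measure unitInterval} [IsFiniteMeasure μ]
    [IsFiniteMeasure ν] (h : ∀ k : ℕ, ∫ y, (y : ℝ) ^ k ∂μ = ∫ y, (y : ℝ) ^ k ∂ν) : μ = ν := by
  have hint (κ : Measure unitInterval) [IsFiniteMeasure κ] (k : ℕ) (a : ℝ) :
      Integrable (fun y : unitInterval => a * (y : ℝ) ^ k) κ :=
    Continuous.integrable_of_hasCompactSupport (by fun_prop) (HasCompactSupport.of_compactSpace _)
  have hpoly (p : Polynomial ℝ) :
      ∫ y : unitInterval, p.eval (y : ℝ) ∂μ = ∫ y : unitInterval, p.eval (y : ℝ) ∂ν := by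
    simp only [Polynomial.eval_eq_sum_range]
    rw [integral_finsetSum _ fun k _ => hint μ k _, integral_finsetSum _ fun k _ => hint ν k _]
    simp only [integral_const_mul, h]
  have hcont (f : C(unitInterval, ℝ)) : ∫ y, f y ∂μ = ∫ y, f y ∂ν := by
    have hclosed : IsClosed {f : C(unitInterval, ℝ) | ∫ y, f y ∂μ = ∫ y, f y ∂ν} :=
      isClosed_eq (continuous_integral_continuousMap μ) (continuous_integral_continuousMap ν)
    refine closure_minimal ?_ hclosed (continuousMap_mem_polynomialFunctions_closure 0 1 f)
    rintro _ ⟨p, -, rfl⟩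
    exact hpoly p
  exact ext_of_forall_integral_eq_of_IsFiniteMeasure fun f => hcont f.toContinuousMap

/-- The substitution `x ↦ e⁻ˣ` carrying `[0, ∞)` to `(0, 1]`, extended by the value `1` to
negative numbers; it turns Laplace transforms into moments. -/
noncomputable def expNegUnit (x : ℝ) : unitInterval := projIcc 0 1 zero_le_one (Real.exp (-x))

theorem coe_expNegUnit {x : ℝ} (hx : 0 ≤ x) : (expNegUnit x : ℝ) = Real.exp (-x) := by
  rw [expNegUnit, projIcc_of_mem _ ⟨by positivity, Real.exp_le_one_iff.2 (neg_nonpos.2 hx)⟩]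

theorem measurable_expNegUnit : Measurable expNegUnit :=
  (continuous_projIcc.comp (by fun_prop)).measurable

theorem map_neg_log_map_expNegUnit {μ : Measure ℝ} (hμ : ∀ᵐ x ∂μ, 0 ≤ x) :
    (μ.map expNegUnit).map (fun y : unitInterval => -Real.log y) = μ := by
  rw [Measure.map_map (by fun_prop) measurable_expNegUnit,
    Measure.map_congr (g := id) (hμ.mono fun x hx => ?_), Measure.map_id]
  simp [coe_expNegUnit hx]

theorem integral_pow_map_expNegUnit {μ : Measure ℝ} (hμ : ∀ᵐ x ∂μ, 0 ≤ x) (k : ℕ) :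
    ∫ y, (y : ℝ) ^ k ∂(μ.map expNegUnit) = ∫ x, Real.exp (-(k * x)) ∂μ := by
  rw [integral_map measurable_expNegUnit.aemeasurable (by fun_prop)]
  refine integral_congr_ae (hμ.mono fun x hx => ?_)
  simp only [coe_expNegUnit hx, ← Real.exp_nat_mul, mul_neg]

theorem ext_of_forall_integral_exp_neg_nat {μ ν : Measure ℝ} [IsFiniteMeasure μ]
    [IsFiniteMeasure ν] (hμ : ∀ᵐ x ∂μ, 0 ≤ x) (hν : ∀ᵐ x ∂ν, 0 ≤ x)
    (h : ∀ k : ℕ, ∫ x, Real.exp (-(k * x)) ∂μ = ∫ x, Real.exp (-(k * x)) ∂ν) : μ = ν := by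
  have hmap : μ.map expNegUnit = ν.map expNegUnit :=
    ext_of_forall_integral_pow_unitInterval fun k => by
      rw [integral_pow_map_expNegUnit hμ, integral_pow_map_expNegUnit hν, h]
  rw [← map_neg_log_map_expNegUnit hμ, hmap, map_neg_log_map_expNegUnit hν]

theorem ext_of_forall_integral_exp_nat {μ ν : Measure ℝ} [IsFiniteMeasure μ] [IsFiniteMeasure ν]
    {a : ℝ} (hμ : ∀ᵐ x ∂μ, x ≤ a) (hν : ∀ᵐ x ∂ν, x ≤ a)
    (h : ∀ k : ℕ, ∫ x, Real.exp (k * x) ∂μ = ∫ x, Real.exp (k * x) ∂ν) : μ = ν := by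
  have hm : Measurable fun x : ℝ => a - x := by fun_prop
  have hpos {κ : Measure ℝ} (hκ : ∀ᵐ x ∂κ, x ≤ a) : ∀ᵐ x ∂κ.map (a - ·), 0 ≤ x :=
    (ae_map_iff hm.aemeasurable measurableSet_Ici).2 (hκ.mono fun x hx => sub_nonneg.2 hx)
  have hint (κ : Measure ℝ) (k : ℕ) : ∫ x, Real.exp (-(k * x)) ∂κ.map (a - ·) =
      Real.exp (-(k * a)) * ∫ x, Real.exp (k * x) ∂κ := by
    rw [integral_map hm.aemeasurable (by fun_prop), ← integral_const_mul]
    simp only [← Real.exp_add]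
    ring_nf
  have hrefl (κ : Measure ℝ) : (κ.map (a - ·)).map (a - ·) = κ := by
    rw [Measure.map_map hm hm]
    simp
  rw [← hrefl μ, ← hrefl ν, ext_of_forall_integral_exp_neg_nat (hpos hμ) (hpos hν) fun k => by
    rw [hint, hint, h]]

/-- The measure `e^{-cx} f(x) dx` on `(0, ∞)`, which is finite when the Laplace transform of `f`
converges at `c`. -/
noncomputable def expNegWeighted (c : ℝ) (f : ℝ → ℝ) : Measure ℝ :=
  (volume.restrict (Ioi 0)).withDensity fun x => ENNReal.ofReal (Real.exp (-c * x) * f x)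

theorem ae_nonneg_expNegWeighted (c : ℝ) (f : ℝ → ℝ) : ∀ᵐ x ∂expNegWeighted c f, 0 ≤ x :=
  (withDensity_absolutelyContinuous _ _).ae_le
    ((ae_restrict_mem measurableSet_Ioi).mono fun _ hx => le_of_lt hx)

theorem integral_exp_neg_mul_expNegWeighted {c : ℝ} {f : ℝ → ℝ} (hf : 0 ≤ f)
    (hint : IntegrableOn (fun x => Real.exp (-c * x) * f x) (Ioi 0)) (r : ℝ) :
    ∫ x, Real.exp (-(r * x)) ∂expNegWeighted c f =
      ∫ x in Ioi 0, Real.exp (-(c + r) * x) * f x := by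
  rw [expNegWeighted, integral_withDensity_eq_integral_toReal_smul₀
    hint.aestronglyMeasurable.aemeasurable.ennreal_ofReal
    (ae_of_all _ fun _ => ENNReal.ofReal_lt_top)]
  refine integral_congr_ae (ae_of_all _ fun x => ?_)
  simp only [smul_eq_mul]
  rw [ENNReal.toReal_ofReal (mul_nonneg (Real.exp_pos _).le (hf x)),
    show -(c + r) * x = -c * x + -(r * x) by ring, Real.exp_add]
  ring

theorem ae_eq_of_forall_integral_exp_neg_mul_eq {f g : ℝ → ℝ} {b : ℝ}
    (hf : 0 ≤ f) (hg : 0 ≤ g)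
    (hf_int : ∀ β, b < β → IntegrableOn (fun x => Real.exp (-β * x) * f x) (Ioi 0))
    (hg_int : ∀ β, b < β → IntegrableOn (fun x => Real.exp (-β * x) * g x) (Ioi 0))
    (h : ∀ β, b < β → ∫ x in Ioi 0, Real.exp (-β * x) * f x =
      ∫ x in Ioi 0, Real.exp (-β * x) * g x) : f =ᵐ[volume.restrict (Ioi 0)] g := by
  have hb := lt_add_one b
  have : IsFiniteMeasure (expNegWeighted (b + 1) f) :=
    isFiniteMeasure_withDensity_ofReal (hf_int _ hb).2
  have : IsFiniteMeasure (expNegWeighted (b + 1) g) :=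
    isFiniteMeasure_withDensity_ofReal (hg_int _ hb).2
  have heq : expNegWeighted (b + 1) f = expNegWeighted (b + 1) g :=
    ext_of_forall_integral_exp_neg_nat (ae_nonneg_expNegWeighted _ f)
      (ae_nonneg_expNegWeighted _ g) fun k => by
      rw [integral_exp_neg_mul_expNegWeighted hf (hf_int _ hb),
        integral_exp_neg_mul_expNegWeighted hg (hg_int _ hb),
        h _ (hb.trans_le (le_add_of_nonneg_right k.cast_nonneg))]
  have hdens := (withDensity_eq_iff (hf_int _ hb).aestronglyMeasurable.aemeasurable.ennreal_ofReal
    (hg_int _ hb).aestronglyMeasurable.aemeasurable.ennreal_ofReal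
    (hf_int _ hb).lintegral_lt_top.ne).1 heq
  filter_upwards [hdens] with x hx
  have hexp := Real.exp_pos (-(b + 1) * x)
  exact mul_left_cancel₀ hexp.ne' ((ENNReal.ofReal_eq_ofReal_iff
    (mul_nonneg hexp.le (hf x)) (mul_nonneg hexp.le (hg x))).1 hx)

theorem eqOn_Ici_of_ae_eq_of_continuousWithinAt {E : Type*} [TopologicalSpace E] [T2Space E]
    {f g : ℝ → E} {a : ℝ} (h : f =ᵐ[volume.restrict (Ioi a)] g)
    (hf : ∀ x, a ≤ x → ContinuousWithinAt f (Ici x) x)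
    (hg : ∀ x, a ≤ x → ContinuousWithinAt g (Ici x) x) : EqOn f g (Ici a) := by
  intro x hx
  refine tendsto_nhds_unique_of_frequently_eq (l := 𝓝[>] x)
    ((hf x hx).mono Ioi_subset_Ici_self) ((hg x hx).mono Ioi_subset_Ici_self) fun hne => ?_
  obtain ⟨b, hxb, hb⟩ := mem_nhdsGT_iff_exists_Ioo_subset.1 hne
  have hnull : volume (Ioo x b) = 0 := by
    refine measure_mono_null (fun y hy => ?_) ((ae_restrict_iff' measurableSet_Ioi).1 h)
    exact fun hfg => hb hy (hfg (lt_of_le_of_lt hx hy.1))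
  rw [Real.volume_Ioo, ENNReal.ofReal_eq_zero, sub_nonpos] at hnull
  exact hnull.not_gt hxb

theorem IsScaleFunction.unique {ψ W₁ W₂ : ℝ → ℝ} (h₁ : IsScaleFunction ψ W₁)
    (h₂ : IsScaleFunction ψ W₂) : W₁ = W₂ := by
  have hae : W₁ =ᵐ[volume.restrict (Ioi 0)] W₂ :=
    ae_eq_of_forall_integral_exp_neg_mul_eq h₁.nonneg h₂.nonneg
      (fun β hβ => (h₁.laplace β hβ).1) (fun β hβ => (h₂.laplace β hβ).1)
      fun β hβ => (h₁.laplace β hβ).2.trans (h₂.laplace β hβ).2.symm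
  ext x
  rcases lt_or_ge x 0 with hx | hx
  · rw [h₁.eq_zero_of_neg x hx, h₂.eq_zero_of_neg x hx]
  · exact eqOn_Ici_of_ae_eq_of_continuousWithinAt hae h₁.right_continuous h₂.right_continuous hx

end LaplaceUniqueness

section LevyMeasure

/-- The integrand of the jump part of the characteristic exponent. -/
noncomputable def levyKhintchineIntegrand (θ x : ℝ) : ℂ :=
  1 - Complex.exp (Complex.I * θ * x) + Complex.I * θ * (if |x| < 1 then (x : ℂ) else 0)

theorem norm_exp_I_mul_mul (θ x : ℝ) : ‖Complex.exp (Complex.I * θ * x)‖ = 1 := by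
  simpa [mul_assoc] using Complex.norm_exp_I_mul_ofReal (θ * x)

theorem norm_one_sub_exp_I_add_le (θ x : ℝ) :
    ‖1 - Complex.exp (Complex.I * θ * x) + Complex.I * θ * x‖ ≤ 3 * (θ * x) ^ 2 := by
  have hnorm : ‖Complex.I * θ * x‖ = |θ * x| := by simp [abs_mul]
  rcases le_or_gt |θ * x| 1 with hsmall | hlarge
  · have htaylor := Complex.norm_exp_sub_one_sub_id_le (hnorm.trans_le hsmall)
    rw [hnorm, sq_abs, ← norm_neg, neg_sub, sub_sub_eq_add_sub, add_comm, add_sub_right_comm]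
      at htaylor
    exact (congrArg norm (by ring)).trans_le (htaylor.trans (by nlinarith [sq_nonneg (θ * x)]))
  · have hexp := norm_sub_le 1 (Complex.exp (Complex.I * θ * x))
    rw [norm_exp_I_mul_mul, norm_one] at hexp
    refine (norm_add_le _ _).trans ?_
    rw [hnorm, ← sq_abs (θ * x)]
    nlinarith

theorem norm_levyKhintchineIntegrand_le (θ x : ℝ) :
    ‖levyKhintchineIntegrand θ x‖ ≤ (3 * θ ^ 2 + 2) * min 1 (x ^ 2) := by
  rcases lt_or_ge |x| 1 with hx | hx
  · rw [levyKhintchineIntegrand, if_pos hx, min_eq_right ((sq_le_one_iff_abs_le_one x).2 hx.le)]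
    exact (norm_one_sub_exp_I_add_le θ x).trans (by nlinarith [sq_nonneg x])
  · rw [levyKhintchineIntegrand, if_neg hx.not_gt, min_eq_left ((one_le_sq_iff_one_le_abs x).2 hx),
      mul_zero, add_zero]
    have hexp := norm_sub_le 1 (Complex.exp (Complex.I * θ * x))
    rw [norm_exp_I_mul_mul, norm_one] at hexp
    nlinarith [sq_nonneg θ]

@[fun_prop]
theorem measurable_levyKhintchineIntegrand (θ : ℝ) : Measurable (levyKhintchineIntegrand θ) := by
  have htrunc : Measurable fun x : ℝ => if |x| < 1 then (x : ℂ) else 0 :=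
    Measurable.ite (measurableSet_lt (by fun_prop) measurable_const) (by fun_prop) (by fun_prop)
  unfold levyKhintchineIntegrand
  fun_prop

theorem integrable_min_one_sq {ν : Measure ℝ}
    (hν : ∫⁻ x, ENNReal.ofReal (min 1 (x ^ 2)) ∂ν < ∞) :
    Integrable (fun x : ℝ => min 1 (x ^ 2)) ν :=
  ⟨by fun_prop, (hasFiniteIntegral_iff_ofReal (ae_of_all _ fun x => by positivity)).2 hν⟩

theorem integrable_levyKhintchineIntegrand {ν : Measure ℝ}
    (hν : ∫⁻ x, ENNReal.ofReal (min 1 (x ^ 2)) ∂ν < ∞) (θ : ℝ) :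
    Integrable (levyKhintchineIntegrand θ) ν :=
  ((integrable_min_one_sq hν).const_mul (3 * θ ^ 2 + 2)).mono' (by fun_prop)
    (ae_of_all _ (norm_levyKhintchineIntegrand_le θ))

theorem two_mul_one_sub_cos_nonneg (x : ℝ) : 0 ≤ 2 * (1 - Real.cos x) := by
  linarith [Real.cos_le_one x]

theorem two_mul_one_sub_cos_mul_le (h x : ℝ) :
    2 * (1 - Real.cos (h * x)) ≤ (4 + h ^ 2) * min 1 (x ^ 2) := by
  rcases min_cases 1 (x ^ 2) with ⟨hmin, -⟩ | ⟨hmin, -⟩ <;> rw [hmin]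
  · nlinarith [Real.neg_one_le_cos (h * x)]
  · nlinarith [sq_nonneg x, Real.one_sub_sq_div_two_le_cos (x := h * x)]

theorem integrable_two_mul_one_sub_cos {ν : Measure ℝ}
    (hν : ∫⁻ x, ENNReal.ofReal (min 1 (x ^ 2)) ∂ν < ∞) (h : ℝ) :
    Integrable (fun x : ℝ => 2 * (1 - Real.cos (h * x))) ν :=
  ((integrable_min_one_sq hν).const_mul (4 + h ^ 2)).mono' (by fun_prop) (ae_of_all _ fun x =>
    (Real.norm_of_nonneg (two_mul_one_sub_cos_nonneg _)).trans_le (two_mul_one_sub_cos_mul_le h x))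

/-- The weighted Lévy measure `2(1 - cos(hx)) ν(dx)`, which is finite and, near each nonzero
point and for small `h`, equivalent to `ν`. -/
noncomputable def cosWeighted (h : ℝ) (ν : Measure ℝ) : Measure ℝ :=
  ν.withDensity fun x => ENNReal.ofReal (2 * (1 - Real.cos (h * x)))

theorem isFiniteMeasure_cosWeighted {ν : Measure ℝ}
    (hν : ∫⁻ x, ENNReal.ofReal (min 1 (x ^ 2)) ∂ν < ∞) (h : ℝ) :
    IsFiniteMeasure (cosWeighted h ν) :=
  isFiniteMeasure_withDensity_ofReal (integrable_two_mul_one_sub_cos hν h).2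

theorem levyKhintchineIntegrand_second_difference (θ h x : ℝ) :
    levyKhintchineIntegrand (θ + h) x + levyKhintchineIntegrand (θ - h) x
      - 2 * levyKhintchineIntegrand θ x =
    (2 * (1 - Real.cos (h * x)) : ℝ) • Complex.exp (θ * x * Complex.I) := by
  have hadd : Complex.exp (Complex.I * (θ + h) * x) =
      Complex.exp (θ * x * Complex.I) * Complex.exp (h * x * Complex.I) := by
    rw [← Complex.exp_add]; ring_nf
  have hsub : Complex.exp (Complex.I * (θ - h) * x) =
      Complex.exp (θ * x * Complex.I) * Complex.exp (-(h * x) * Complex.I) := by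
    rw [← Complex.exp_add]; ring_nf
  have hmid : Complex.exp (Complex.I * θ * x) = Complex.exp (θ * x * Complex.I) := by ring_nf
  have hcos : Complex.exp (h * x * Complex.I) + Complex.exp (-(h * x) * Complex.I) =
      2 * Complex.cos (h * x) := by
    rw [Complex.cos]; ring
  rw [Complex.real_smul]
  simp only [levyKhintchineIntegrand]
  push_cast
  rw [hadd, hsub, hmid]
  linear_combination -(Complex.exp (θ * x * Complex.I)) * hcos

theorem charFun_cosWeighted {ν : Measure ℝ}
    (hν : ∫⁻ x, ENNReal.ofReal (min 1 (x ^ 2)) ∂ν < ∞) (h θ : ℝ) :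
    charFun (cosWeighted h ν) θ =
      ∫ x, levyKhintchineIntegrand (θ + h) x ∂ν + ∫ x, levyKhintchineIntegrand (θ - h) x ∂ν
        - 2 * ∫ x, levyKhintchineIntegrand θ x ∂ν := by
  have hint := integrable_levyKhintchineIntegrand hν
  have hsum : Integrable
      (fun x => levyKhintchineIntegrand (θ + h) x + levyKhintchineIntegrand (θ - h) x) ν :=
    (hint _).add (hint _)
  rw [← integral_const_mul, ← integral_add (hint _) (hint _),
    ← integral_sub hsum ((hint θ).const_mul 2),
    charFun_apply_real, cosWeighted, integral_withDensity_eq_integral_toReal_smul (by fun_prop)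
      (ae_of_all _ fun _ => ENNReal.ofReal_lt_top)]
  refine integral_congr_ae (ae_of_all _ fun x => ?_)
  simp only
  rw [levyKhintchineIntegrand_second_difference,
    ENNReal.toReal_ofReal (two_mul_one_sub_cos_nonneg _)]

theorem levyKhintchineExponent_second_difference {ν : Measure ℝ}
    (hν : ∫⁻ x, ENNReal.ofReal (min 1 (x ^ 2)) ∂ν < ∞) (μ σ h θ : ℝ) :
    levyKhintchineExponent μ σ ν (θ + h) + levyKhintchineExponent μ σ ν (θ - h)
      - 2 * levyKhintchineExponent μ σ ν θ =
    charFun (cosWeighted h ν) θ + (σ ^ 2 * h ^ 2 : ℝ) := by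
  rw [charFun_cosWeighted hν]
  simp only [levyKhintchineExponent, levyKhintchineIntegrand]
  push_cast
  ring

theorem charFun_measure_add {μ ν : Measure ℝ} [IsFiniteMeasure μ] [IsFiniteMeasure ν] (θ : ℝ) :
    charFun (μ + ν) θ = charFun μ θ + charFun ν θ := by
  have hint (κ : Measure ℝ) [IsFiniteMeasure κ] :
      Integrable (fun x : ℝ => Complex.exp (θ * x * Complex.I)) κ :=
    Integrable.of_bound (C := 1) (by fun_prop) <| ae_of_all _ fun x => by
      rw [← Complex.ofReal_mul, Complex.norm_exp_ofReal_mul_I]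
  simp only [charFun_apply_real, integral_add_measure (hint μ) (hint ν)]

theorem cosWeighted_eq_of_levyKhintchineExponent_eq {μ₁ σ₁ μ₂ σ₂ : ℝ} {ν₁ ν₂ : Measure ℝ}
    (hν₁ : ν₁ {0} = 0) (hν₂ : ν₂ {0} = 0)
    (hint₁ : ∫⁻ x, ENNReal.ofReal (min 1 (x ^ 2)) ∂ν₁ < ∞)
    (hint₂ : ∫⁻ x, ENNReal.ofReal (min 1 (x ^ 2)) ∂ν₂ < ∞)
    (h : levyKhintchineExponent μ₁ σ₁ ν₁ = levyKhintchineExponent μ₂ σ₂ ν₂) (r : ℝ) :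
    cosWeighted r ν₁ = cosWeighted r ν₂ := by
  have := isFiniteMeasure_cosWeighted hint₁ r
  have := isFiniteMeasure_cosWeighted hint₂ r
  let atom (σ : ℝ) : Measure ℝ := ENNReal.ofReal (σ ^ 2 * r ^ 2) • Measure.dirac 0
  have (σ : ℝ) : IsFiniteMeasure (atom σ) := Measure.smul_finite _ ENNReal.ofReal_ne_top
  have hatom (σ θ : ℝ) : charFun (atom σ) θ = (σ ^ 2 * r ^ 2 : ℝ) := by
    simp [atom, charFun_apply_real, integral_smul_measure, -Complex.ofReal_mul,
      ENNReal.toReal_ofReal (by positivity : 0 ≤ σ ^ 2 * r ^ 2)]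
  have heq : cosWeighted r ν₁ + atom σ₁ = cosWeighted r ν₂ + atom σ₂ :=
    Measure.ext_of_charFun <| funext fun θ => by
      rw [charFun_measure_add, charFun_measure_add, hatom, hatom,
        ← levyKhintchineExponent_second_difference hint₁ μ₁,
        ← levyKhintchineExponent_second_difference hint₂ μ₂, h]
  have hrestrict {ν : Measure ℝ} (hν : ν {0} = 0) (σ : ℝ) :
      (cosWeighted r ν + atom σ).restrict {0}ᶜ = cosWeighted r ν := by
    have hac : cosWeighted r ν {0} = 0 := withDensity_absolutelyContinuous _ _ hν
    rw [Measure.restrict_add, Measure.restrict_smul, (Measure.restrict_eq_zero (s := {0}ᶜ)).2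
      (by simp : Measure.dirac (0 : ℝ) {0}ᶜ = 0), smul_zero, add_zero]
    exact Measure.restrict_eq_self_of_ae_mem (compl_mem_ae_iff.2 hac)
  rw [← hrestrict hν₁ σ₁, heq, hrestrict hν₂]

theorem two_mul_one_sub_cos_inv_mul_pos {a x : ℝ} (ha : 0 < a) (hx : x ∈ Icc (-a) a)
    (hx₀ : x ≠ 0) : 0 < 2 * (1 - Real.cos (a⁻¹ * x)) := by
  have hle : |a⁻¹ * x| ≤ 1 := by
    rw [abs_mul, abs_of_pos (inv_pos.2 ha), inv_mul_le_iff₀ ha, mul_one]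
    exact abs_le.2 hx
  have hπ := Real.pi_gt_three
  have hcos : Real.cos (a⁻¹ * x) ≠ 1 := by
    rw [ne_eq, Real.cos_eq_one_iff_of_lt_of_lt (by linarith [neg_le_of_abs_le hle])
      (by linarith [le_of_abs_le hle])]
    exact mul_ne_zero (inv_pos.2 ha).ne' hx₀
  linarith [(Real.cos_le_one _).lt_of_ne hcos]

theorem restrict_eq_withDensity_inv_cosWeighted {ν : Measure ℝ} (hν : ν {0} = 0) {a : ℝ}
    (ha : 0 < a) : ν.restrict (Icc (-a) a) = ((cosWeighted a⁻¹ ν).restrict (Icc (-a) a)).withDensity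
      fun x => (ENNReal.ofReal (2 * (1 - Real.cos (a⁻¹ * x))))⁻¹ := by
  rw [cosWeighted, restrict_withDensity measurableSet_Icc]
  refine (withDensity_inv_same (by fun_prop) ?_ (ae_of_all _ fun x => ENNReal.ofReal_ne_top)).symm
  rw [ae_restrict_iff' measurableSet_Icc]
  filter_upwards [compl_mem_ae_iff.2 hν] with x hx₀ hx
  exact (ENNReal.ofReal_pos.2 (two_mul_one_sub_cos_inv_mul_pos ha hx hx₀)).ne'

theorem levyMeasure_eq_of_levyKhintchineExponent_eq {μ₁ σ₁ μ₂ σ₂ : ℝ} {ν₁ ν₂ : Measure ℝ}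
    (hν₁ : ν₁ {0} = 0) (hν₂ : ν₂ {0} = 0)
    (hint₁ : ∫⁻ x, ENNReal.ofReal (min 1 (x ^ 2)) ∂ν₁ < ∞)
    (hint₂ : ∫⁻ x, ENNReal.ofReal (min 1 (x ^ 2)) ∂ν₂ < ∞)
    (h : levyKhintchineExponent μ₁ σ₁ ν₁ = levyKhintchineExponent μ₂ σ₂ ν₂) : ν₁ = ν₂ := by
  have hcover : (⋃ n : ℕ, Icc (-(n + 1 : ℝ)) (n + 1)) = univ := by
    refine eq_univ_of_forall fun x => ?_
    obtain ⟨n, hn⟩ := exists_nat_ge |x|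
    exact mem_iUnion.2 ⟨n, abs_le.1 (hn.trans (lt_add_one _).le)⟩
  refine Measure.ext_of_iUnion_eq_univ hcover fun n => ?_
  rw [restrict_eq_withDensity_inv_cosWeighted hν₁ n.cast_add_one_pos,
    restrict_eq_withDensity_inv_cosWeighted hν₂ n.cast_add_one_pos,
    cosWeighted_eq_of_levyKhintchineExponent_eq hν₁ hν₂ hint₁ hint₂ h]

theorem eq_of_forall_exp_neg_mul_eq {a b : ℂ}
    (h : ∀ t : ℝ≥0, Complex.exp (-(t : ℂ) * a) = Complex.exp (-(t : ℂ) * b)) : a = b := by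
  have hderiv (c : ℂ) :
      HasDerivWithinAt (fun t : ℝ => Complex.exp (-(t : ℂ) * c)) (-c) (Ici 0) 0 := by
    have hlin : HasDerivAt (fun t : ℝ => -(t : ℂ) * c) (-c) 0 := by
      simpa using ((Complex.ofRealCLM.hasDerivAt (x := (0 : ℝ))).neg).mul_const c
    simpa using hlin.cexp.hasDerivWithinAt (s := Ici 0)
  have hb := (hderiv a).congr (f₁ := fun t : ℝ => Complex.exp (-(t : ℂ) * b))
    (fun t ht => (h ⟨t, ht⟩).symm) (h 0).symm
  exact neg_injective ((uniqueDiffWithinAt_Ici (0 : ℝ)).eq_deriv _ hb (hderiv b))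

theorem HasLevyTriplet.levyMeasure_eq {Ω Ω' : Type*} [MeasurableSpace Ω] [MeasurableSpace Ω']
    {X : ℝ≥0 → Ω → ℝ} {P : Measure Ω} {Y : ℝ≥0 → Ω' → ℝ} {P' : Measure Ω'}
    {μ₁ σ₁ μ₂ σ₂ : ℝ} {ν₁ ν₂ : Measure ℝ}
    (hX : HasLevyTriplet X P μ₁ σ₁ ν₁) (hY : HasLevyTriplet Y P' μ₂ σ₂ ν₂)
    (h : ∀ t, IdentDistrib (X t) (Y t) P P') : ν₁ = ν₂ := by
  refine levyMeasure_eq_of_levyKhintchineExponent_eq hX.no_mass_zero hY.no_mass_zero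
    hX.lintegral_lt_top hY.lintegral_lt_top (μ₁ := μ₁) (σ₁ := σ₁) (μ₂ := μ₂) (σ₂ := σ₂)
    (funext fun θ => eq_of_forall_exp_neg_mul_eq fun t => ?_)
  rw [← hX.exponent, ← hY.exponent]
  exact ((h t).comp (u := fun x : ℝ => Complex.exp (Complex.I * θ * x)) (by fun_prop)).integral_eq

end LevyMeasure

section LevyPaths

theorem monotone_of_monotoneOn_dense {α β : Type*} [LinearOrder α] [TopologicalSpace α]
    [OrderTopology α] [DenselyOrdered α] [NoMaxOrder α] [Preorder β] [TopologicalSpace β]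
    [OrderClosedTopology β] {f : α → β} {D : Set α} (hD : Dense D)
    (hf : ∀ t, ContinuousWithinAt f (Ici t) t) (hmono : MonotoneOn f D) : Monotone f := by
  have hne (s : α) : (𝓝[D ∩ Ioi s] s).NeBot := by
    rw [← mem_closure_iff_nhdsWithin_neBot, inter_comm]
    refine closure_minimal (hD.open_subset_closure_inter isOpen_Ioi) isClosed_closure ?_
    rw [closure_Ioi]
    exact self_mem_Ici
  have hlim (s : α) : Tendsto f (𝓝[D ∩ Ioi s] s) (𝓝 (f s)) :=
    (hf s).mono_left (nhdsWithin_mono _ fun x hx => Ioi_subset_Ici_self hx.2)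
  have hle (s : α) {d : α} (hd : d ∈ D) (hsd : s < d) : f s ≤ f d := by
    refine le_of_tendsto (hlim s) ?_
    filter_upwards [self_mem_nhdsWithin, mem_nhdsWithin_of_mem_nhds (Iio_mem_nhds hsd)]
      with x hx hxd using hmono hx.1 hd (le_of_lt hxd)
  intro s t hst
  refine ge_of_tendsto (hlim t) ?_
  filter_upwards [self_mem_nhdsWithin] with x hx using hle s hx.1 (hst.trans_lt hx.2)

theorem locallyBoundedVariationOn_sub_of_monotoneOn {α : Type*} [LinearOrder α] {f g : α → ℝ}
    {s : Set α} (hf : MonotoneOn f s) (hg : MonotoneOn g s) :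
    LocallyBoundedVariationOn (fun x => f x - g x) s := by
  intro a b ha hb
  refine ne_top_of_le_ne_top ((hf.add hg).locallyBoundedVariationOn a b ha hb) ?_
  refine iSup_mono fun p => Finset.sum_le_sum fun i _ => ?_
  have hp : p.2.1 i ≤ p.2.1 (i + 1) := p.2.2.1 i.le_succ
  have hfi := hf (p.2.2.2 i).1 (p.2.2.2 (i + 1)).1 hp
  have hgi := hg (p.2.2.2 i).1 (p.2.2.2 (i + 1)).1 hp
  rw [edist_dist, edist_dist, Real.dist_eq, Real.dist_eq]
  refine ENNReal.ofReal_le_ofReal ((abs_le.2 ⟨?_, ?_⟩).trans (le_abs_self _)) <;>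
    simp only <;> linarith

variable {Ω : Type*} [MeasurableSpace Ω] {P : Measure Ω} {X : ℝ≥0 → Ω → ℝ} {ψ : ℝ → ℝ}

theorem IsLevyProcess.ae_monotone_mul_sub (hX : IsLevyProcess X P) {c : ℝ}
    (h : ∀ t, ∀ᵐ ω ∂P, X t ω ≤ c * t) :
    ∀ᵐ ω ∂P, Monotone fun t : ℝ≥0 => c * t - X t ω := by
  obtain ⟨D, hDc, hD⟩ := TopologicalSpace.exists_countable_dense ℝ≥0
  have hinc (s t : ℝ≥0) (hst : s ≤ t) : ∀ᵐ ω ∂P, X t ω - X s ω ≤ c * (t - s) := by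
    have hlaw : ∀ᵐ x ∂(P.map (X (t - s))), x ≤ c * ((t - s : ℝ≥0) : ℝ) :=
      (ae_map_iff (hX.measurable _).aemeasurable measurableSet_Iic).2 (h (t - s))
    rw [← hX.stationary_increments s t hst, NNReal.coe_sub hst] at hlaw
    exact ae_of_ae_map ((hX.measurable t).sub (hX.measurable s)).aemeasurable hlaw
  have hall : ∀ᵐ ω ∂P, ∀ s ∈ D, ∀ t ∈ D, s ≤ t → X t ω - X s ω ≤ c * (t - s) :=
    (ae_ball_iff hDc).2 fun s _ => (ae_ball_iff hDc).2 fun t _ =>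
      eventually_imp_distrib_left.2 (hinc s t)
  filter_upwards [hall] with ω hω
  refine monotone_of_monotoneOn_dense hD (fun t => ?_) fun s hs t ht hst => ?_
  · exact (Continuous.continuousWithinAt (by fun_prop)).sub (hX.cadlag ω t).1
  · linarith [hω s hs t ht hst]

theorem hasBoundedVariationPaths_of_monotone_mul_sub {c : ℝ}
    (h : ∀ᵐ ω ∂P, Monotone fun t : ℝ≥0 => c * t - X t ω) : HasBoundedVariationPaths X P := by
  filter_upwards [h] with ω hω
  have hlin {a : ℝ} (ha : 0 ≤ a) : Monotone fun t : ℝ≥0 => a * (t : ℝ) := fun s t hst =>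
    mul_le_mul_of_nonneg_left (NNReal.coe_le_coe.2 hst) ha
  have hrest : Monotone fun t : ℝ≥0 => (|c| - c) * t + (c * t - X t ω) :=
    (hlin (sub_nonneg.2 (le_abs_self c))).add hω
  convert locallyBoundedVariationOn_sub_of_monotoneOn
    ((hlin (abs_nonneg c)).monotoneOn univ) (hrest.monotoneOn univ) using 2
  ring

theorem hasBoundedVariationPaths_of_monotone_add_id
    (h : ∀ᵐ ω ∂P, Monotone fun t : ℝ≥0 => X t ω + t) : HasBoundedVariationPaths X P := by
  filter_upwards [h] with ω hω
  simpa using locallyBoundedVariationOn_sub_of_monotoneOn (hω.monotoneOn univ)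
    (NNReal.coe_mono.monotoneOn univ)

theorem hasBoundedVariationPaths_of_antitone_add_id
    (h : ∀ᵐ ω ∂P, Antitone fun t : ℝ≥0 => X t ω + t) : HasBoundedVariationPaths X P :=
  hasBoundedVariationPaths_of_monotone_mul_sub (c := -1) <| h.mono fun ω hω => by
    simpa [sub_eq_add_neg, add_comm] using hω.neg

theorem HasLaplaceExponent.measure_mul_add_le_eq_zero [IsFiniteMeasure P]
    (hψ : HasLaplaceExponent X P ψ) {c : ℝ} (h : ∀ l, 0 < l → ψ l ≤ c * l) (t : ℝ≥0) {ε : ℝ}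
    (hε : 0 < ε) : P {ω | c * t + ε ≤ X t ω} = 0 := by
  have hchernoff (l : ℝ) (hl : 0 < l) :
      P.real {ω | c * t + ε ≤ X t ω} ≤ Real.exp (-(l * ε)) := by
    refine (measure_ge_le_exp_mul_mgf (c * t + ε) hl.le (hψ t l hl.le).1).trans ?_
    rw [mgf, (hψ t l hl.le).2, ← Real.exp_add]
    have hmul : ψ l * t ≤ c * l * t := mul_le_mul_of_nonneg_right (h l hl) t.coe_nonneg
    exact Real.exp_le_exp.2 (by linarith)
  have hlim : Tendsto (fun l : ℝ => Real.exp (-(l * ε))) atTop (𝓝 0) :=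
    Real.tendsto_exp_neg_atTop_nhds_zero.comp (tendsto_id.atTop_mul_const hε)
  have hnonpos := ge_of_tendsto hlim ((eventually_gt_atTop 0).mono hchernoff)
  exact (measureReal_eq_zero_iff (measure_ne_top _ _)).1 (le_antisymm hnonpos measureReal_nonneg)

theorem HasLaplaceExponent.ae_le_mul [IsFiniteMeasure P] (hψ : HasLaplaceExponent X P ψ)
    {c : ℝ} (h : ∀ l, 0 < l → ψ l ≤ c * l) (t : ℝ≥0) : ∀ᵐ ω ∂P, X t ω ≤ c * t := by
  have hall : ∀ᵐ ω ∂P, ∀ n : ℕ, X t ω < c * t + 1 / ((n : ℝ) + 1) := by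
    refine ae_all_iff.2 fun n => ae_iff.2 ?_
    simpa only [not_lt] using hψ.measure_mul_add_le_eq_zero h t n.one_div_pos_of_nat
  filter_upwards [hall] with ω hω
  have hlim := (tendsto_one_div_add_atTop_nhds_zero_nat (𝕜 := ℝ)).const_add (c * t)
  rw [add_zero] at hlim
  exact ge_of_tendsto hlim (Eventually.of_forall fun n => (hω n).le)

theorem IsLevyProcess.hasBoundedVariationPaths (hX : IsLevyProcess X P)
    (hψ : HasLaplaceExponent X P ψ) {c : ℝ} (h : ∀ l, 0 < l → ψ l ≤ c * l) :
    HasBoundedVariationPaths X P :=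
  have := hX.isProbabilityMeasure
  hasBoundedVariationPaths_of_monotone_mul_sub (hX.ae_monotone_mul_sub (hψ.ae_le_mul h))

theorem HasLaplaceExponent.identDistrib {Ω' : Type*} [MeasurableSpace Ω'] {P' : Measure Ω'}
    {Y : ℝ≥0 → Ω' → ℝ} [IsFiniteMeasure P] [IsFiniteMeasure P'] (hX : HasLaplaceExponent X P ψ)
    (hY : HasLaplaceExponent Y P' ψ) (hXm : ∀ t, Measurable (X t)) (hYm : ∀ t, Measurable (Y t))
    {c : ℝ} (h : ∀ l, 0 < l → ψ l ≤ c * l) (t : ℝ≥0) : IdentDistrib (X t) (Y t) P P' where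
  aemeasurable_fst := (hXm t).aemeasurable
  aemeasurable_snd := (hYm t).aemeasurable
  map_eq := ext_of_forall_integral_exp_nat
    ((ae_map_iff (hXm t).aemeasurable measurableSet_Iic).2 (hX.ae_le_mul h t))
    ((ae_map_iff (hYm t).aemeasurable measurableSet_Iic).2 (hY.ae_le_mul h t)) fun k => by
      rw [integral_map (hXm t).aemeasurable (by fun_prop),
        integral_map (hYm t).aemeasurable (by fun_prop), (hX t k k.cast_nonneg).2,
        (hY t k k.cast_nonneg).2]

theorem HasLaplaceExponent.congr {ψ' : ℝ → ℝ} (hψ : HasLaplaceExponent X P ψ)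
    (h : EqOn ψ ψ' (Ici 0)) : HasLaplaceExponent X P ψ' := fun t l hl =>
  h (mem_Ici.2 hl) ▸ hψ t l hl

theorem HasLaplaceExponent.apply_zero [IsProbabilityMeasure P]
    (hψ : HasLaplaceExponent X P ψ) : ψ 0 = 0 := by
  simpa using (hψ 1 0 le_rfl).2.symm

theorem exp_half_mul_sq (θ x : ℝ) : Real.exp (θ / 2 * x) ^ 2 = Real.exp (θ * x) := by
  rw [← Real.exp_nat_mul]
  ring_nf

theorem HasLaplaceExponent.memLp_exp_half (hψ : HasLaplaceExponent X P ψ) {θ : ℝ} (hθ : 0 ≤ θ)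
    (t : ℝ≥0) : MemLp (fun ω => Real.exp (θ / 2 * X t ω)) 2 P := by
  rw [memLp_two_iff_integrable_sq (hψ t _ (by positivity)).1.aestronglyMeasurable]
  simpa only [exp_half_mul_sq] using (hψ t θ hθ).1

theorem HasLaplaceExponent.variance_exp_half [IsProbabilityMeasure P]
    (hψ : HasLaplaceExponent X P ψ) {θ : ℝ} (hθ : 0 ≤ θ) (t : ℝ≥0) :
    variance (fun ω => Real.exp (θ / 2 * X t ω)) P =
      Real.exp (ψ θ * t) - Real.exp (2 * ψ (θ / 2) * t) := by
  rw [variance_eq_sub (hψ.memLp_exp_half hθ t), (hψ t _ (by positivity)).2, ← Real.exp_nat_mul]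
  simp only [Pi.pow_def, exp_half_mul_sq, (hψ t θ hθ).2]
  ring_nf

theorem HasLaplaceExponent.two_mul_half_le [IsProbabilityMeasure P]
    (hψ : HasLaplaceExponent X P ψ) {θ : ℝ} (hθ : 0 ≤ θ) : 2 * ψ (θ / 2) ≤ ψ θ := by
  have hvar := variance_nonneg (fun ω => Real.exp (θ / 2 * X 1 ω)) P
  simpa [hψ.variance_exp_half hθ] using hvar

theorem HasLaplaceExponent.two_pow_mul_le [IsProbabilityMeasure P]
    (hψ : HasLaplaceExponent X P ψ) {θ : ℝ} (hθ : 0 ≤ θ) (n : ℕ) :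
    2 ^ n * ψ (θ / 2 ^ n) ≤ ψ θ := by
  induction n with
  | zero => simp
  | succ n ih =>
    have hhalf := hψ.two_mul_half_le (θ := θ / 2 ^ n) (by positivity)
    rw [div_div, ← pow_succ] at hhalf
    calc 2 ^ (n + 1) * ψ (θ / 2 ^ (n + 1)) = 2 ^ n * (2 * ψ (θ / 2 ^ (n + 1))) := by ring
      _ ≤ 2 ^ n * ψ (θ / 2 ^ n) := by gcongr
      _ ≤ ψ θ := ih

theorem HasLaplaceExponent.nonneg [IsProbabilityMeasure P] (hψ : HasLaplaceExponent X P ψ)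
    (hd : HasDerivWithinAt ψ 0 (Ioi 0) 0) {θ : ℝ} (hθ : 0 < θ) : 0 ≤ ψ θ := by
  have hseq : Tendsto (fun n : ℕ => θ / 2 ^ n) atTop (𝓝[>] 0) :=
    tendsto_nhdsWithin_iff.2 ⟨tendsto_const_nhds.div_atTop
      (tendsto_pow_atTop_atTop_of_one_lt one_lt_two),
      Eventually.of_forall fun n => mem_Ioi.2 (by positivity)⟩
  have hslope := hasDerivWithinAt_iff_tendsto_slope' (self_notMem_Ioi) |>.1 hd
  have hlim := (hslope.comp hseq).const_mul θ
  rw [mul_zero] at hlim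
  refine le_of_tendsto hlim (Eventually.of_forall fun n => le_trans (le_of_eq ?_)
    (hψ.two_pow_mul_le hθ.le n))
  simp only [Function.comp_apply, slope_def_field, hψ.apply_zero, sub_zero]
  field_simp

theorem HasLaplaceExponent.ae_eq_zero [IsProbabilityMeasure P]
    (hψ : HasLaplaceExponent X P ψ) {θ : ℝ} (hθ : 0 < θ) (h : ψ θ = 0) (h_half : ψ (θ / 2) = 0)
    (t : ℝ≥0) : ∀ᵐ ω ∂P, X t ω = 0 := by
  have hvar : variance (fun ω => Real.exp (θ / 2 * X t ω)) P = 0 := by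
    simp [hψ.variance_exp_half hθ.le, h, h_half]
  filter_upwards [ae_eq_integral_of_variance_eq_zero (hψ.memLp_exp_half hθ.le t) hvar] with ω hω
  rw [(hψ t _ (by positivity)).2, h_half, zero_mul, Real.exp_zero, Real.exp_eq_one_iff] at hω
  exact (mul_eq_zero.1 hω).resolve_left (by positivity)

theorem IsSpectrallyNegativeLevy.exponent_pos (hX : IsSpectrallyNegativeLevy X P)
    (hψ : HasLaplaceExponent X P ψ) (hd : HasDerivWithinAt ψ 0 (Ioi 0) 0) {θ : ℝ} (hθ : 0 < θ) :
    0 < ψ θ := by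
  have := hX.isLevyProcess.isProbabilityMeasure
  refine (hψ.nonneg hd hθ).lt_of_ne fun hzero => hX.not_antitone ?_
  have hhalf : ψ (θ / 2) = 0 := by
    linarith [hψ.two_mul_half_le hθ.le, hψ.nonneg hd (half_pos hθ)]
  have hmono := hX.isLevyProcess.ae_monotone_mul_sub (c := 0) fun t =>
    (hψ.ae_eq_zero hθ hzero.symm hhalf t).mono fun ω hω => by simp [hω]
  filter_upwards [hmono] with ω hω s t hst
  simpa using hω hst

theorem HasLaplaceExponent.integrable_of_ae_nonneg (hψ : HasLaplaceExponent X P ψ) {t : ℝ≥0}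
    (hX : AEStronglyMeasurable (X t) P) (h : ∀ᵐ ω ∂P, 0 ≤ X t ω) : Integrable (X t) P := by
  refine (hψ t 1 zero_le_one).1.mono' hX (h.mono fun ω hω => ?_)
  rw [Real.norm_of_nonneg hω, one_mul]
  linarith [Real.add_one_le_exp (X t ω)]

theorem HasLaplaceExponent.integral_nonpos [IsProbabilityMeasure P]
    (hψ : HasLaplaceExponent X P ψ) (hd : HasDerivWithinAt ψ 0 (Ioi 0) 0)
    (hX : Integrable (X 1) P) : ∫ ω, X 1 ω ∂P ≤ 0 := by
  have hslope := hasDerivWithinAt_iff_tendsto_slope' self_notMem_Ioi |>.1 hd.exp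
  rw [mul_zero] at hslope
  refine ge_of_tendsto hslope (eventually_nhdsWithin_of_forall fun θ (hθ : 0 < θ) => ?_)
  have hint := (hX.const_mul θ).add (integrable_const 1)
  have hle := integral_mono hint (hψ 1 θ hθ.le).1 fun ω => Real.add_one_le_exp (θ * X 1 ω)
  rw [integral_add' (hX.const_mul θ) (integrable_const 1), integral_const_mul,
    (hψ 1 θ hθ.le).2, integral_const, probReal_univ, one_smul, NNReal.coe_one, mul_one] at hle
  rw [slope_def_field, hψ.apply_zero, Real.exp_zero, sub_zero, le_div_iff₀ hθ]
  linarith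

theorem IsLevyProcess.not_monotone_of_hasDerivWithinAt (hX : IsLevyProcess X P)
    (hψ : HasLaplaceExponent X P ψ) (hd : HasDerivWithinAt ψ 0 (Ioi 0) 0) (hpos : 0 < ψ 1) :
    ¬ ∀ᵐ ω ∂P, Monotone fun t => X t ω := by
  have := hX.isProbabilityMeasure
  intro hmono
  have hnonneg : 0 ≤ᵐ[P] X 1 := by
    filter_upwards [hmono, hX.start_zero] with ω hω hzero
    exact hzero.symm.trans_le (hω zero_le_one)
  have hint := hψ.integrable_of_ae_nonneg (hX.measurable 1).aestronglyMeasurable hnonneg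
  have hzero : X 1 =ᵐ[P] 0 := (integral_eq_zero_iff_of_nonneg_ae hnonneg hint).1
    (le_antisymm (hψ.integral_nonpos hd hint) (integral_nonneg_of_ae hnonneg))
  have hexp : ∫ ω, Real.exp (1 * X 1 ω) ∂P = ∫ _, (1 : ℝ) ∂P :=
    integral_congr_ae (hzero.mono fun ω hω => by simp [hω])
  rw [(hψ 1 1 zero_le_one).2] at hexp
  simp [hpos.ne'] at hexp

theorem IsLevyProcess.not_antitone_of_exponent_pos (hX : IsLevyProcess X P)
    (hψ : HasLaplaceExponent X P ψ) (hpos : 0 < ψ 1) : ¬ ∀ᵐ ω ∂P, Antitone fun t => X t ω := by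
  have := hX.isProbabilityMeasure
  intro hanti
  have hle := integral_mono_ae (hψ 1 1 zero_le_one).1 (integrable_const 1) <| by
    filter_upwards [hanti, hX.start_zero] with ω hω hzero
    simpa [hzero] using hω zero_le_one
  rw [(hψ 1 1 zero_le_one).2] at hle
  simp [hpos.not_ge] at hle

theorem IsLevyProcess.mul_add_mul (hX : IsLevyProcess X P) (a c : ℝ) :
    IsLevyProcess (fun t ω => a * X t ω + c * t) P where
  isProbabilityMeasure := hX.isProbabilityMeasure
  measurable t := ((hX.measurable t).const_mul a).add_const _
  cadlag ω t := by
    have hdrift : Continuous fun s : ℝ≥0 => c * (s : ℝ) := by fun_prop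
    obtain ⟨hright, l, hl⟩ := hX.cadlag ω t
    exact ⟨(hright.const_mul a).add hdrift.continuousWithinAt, a * l + c * t,
      (hl.const_mul a).add (hdrift.continuousWithinAt (s := Iio t))⟩
  start_zero := hX.start_zero.mono fun ω hω => by simp [hω]
  indep_increments n t ht := by
    convert! (hX.indep_increments n t ht).comp
      (fun i x => a * x + c * (((t i.succ : ℝ≥0) : ℝ) - t i.castSucc)) (fun i => by fun_prop)
      using 2 with i
    ext ω
    simp only [Function.comp]
    ring
  stationary_increments s t hst := by
    have hlaw := congrArg (Measure.map fun x : ℝ => a * x + c * (t - s : ℝ))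
      (hX.stationary_increments s t hst)
    have hincr : Measurable fun ω => X t ω - X s ω := (hX.measurable t).sub (hX.measurable s)
    rw [Measure.map_map (by fun_prop) hincr, Measure.map_map (by fun_prop) (hX.measurable _)]
      at hlaw
    convert hlaw using 2 <;> ext ω <;> simp only [Function.comp, NNReal.coe_sub hst]
    ring

theorem HasLevyTriplet.add_id {μ σ : ℝ} {ν : Measure ℝ} (h : HasLevyTriplet X P μ σ ν) :
    HasLevyTriplet (fun t ω => X t ω + t) P (μ - 1) σ ν where
  no_mass_zero := h.no_mass_zero
  lintegral_lt_top := h.lintegral_lt_top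
  exponent t θ := by
    have hsplit (ω : Ω) : Complex.exp (Complex.I * θ * ((X t ω + t : ℝ) : ℂ)) =
        Complex.exp (Complex.I * θ * X t ω) * Complex.exp (Complex.I * θ * t) := by
      rw [← Complex.exp_add]
      push_cast
      ring_nf
    simp only [hsplit]
    rw [integral_mul_const, h.exponent, ← Complex.exp_add]
    simp only [levyKhintchineExponent]
    push_cast
    ring_nf

theorem HasLaplaceExponent.add_id (hψ : HasLaplaceExponent X P ψ) :
    HasLaplaceExponent (fun t ω => X t ω + t) P (fun θ => ψ θ + θ) := by
  intro t l hl
  simp only [mul_add, add_mul, Real.exp_add]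
  exact ⟨(hψ t l hl).1.mul_const _, by rw [integral_mul_const, (hψ t l hl).2]⟩

theorem IsSpectrallyNegativeLevy.add_id (hX : IsSpectrallyNegativeLevy X P)
    (hvar : ¬ HasBoundedVariationPaths X P) :
    IsSpectrallyNegativeLevy (fun t ω => X t ω + t) P where
  isLevyProcess := by simpa using hX.isLevyProcess.mul_add_mul 1 1
  jumps_neg := by
    obtain ⟨μ, σ, ν, htriplet, hν⟩ := hX.jumps_neg
    exact ⟨μ - 1, σ, ν, htriplet.add_id, hν⟩
  not_monotone h := hvar (hasBoundedVariationPaths_of_monotone_add_id h)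
  not_antitone h := hvar (hasBoundedVariationPaths_of_antitone_add_id h)

end LevyPaths

section Stieltjes

/-- `f` is a Stieltjes function: on `(0, ∞)` it is a mixture of the constants and of the kernels
`θ ↦ (θ + s)⁻¹`, `s ≥ 0`. Parametrising by `s = (1 - y) / y`, `y ∈ [0, 1]`, turns the mixing measure
into a finite measure on a compact space. Unrelated to Mathlib's `StieltjesFunction`. -/
def IsStieltjes (f : ℝ → ℝ) : Prop :=
  ∃ Q : Measure unitInterval, IsFiniteMeasure Q ∧
    ∀ θ, 0 < θ → f θ = ∫ y : unitInterval, (θ * (y : ℝ) + (1 - y))⁻¹ ∂Q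

theorem mul_add_one_sub_pos {θ : ℝ} (hθ : 0 < θ) (y : unitInterval) :
    0 < θ * (y : ℝ) + (1 - y) := by
  rcases y.2.1.eq_or_lt with h | h
  · simp [← h]
  · exact add_pos_of_pos_of_nonneg (mul_pos hθ h) (sub_nonneg.2 y.2.2)

theorem continuous_inv_mul_add_one_sub {θ : ℝ} (hθ : 0 < θ) :
    Continuous fun y : unitInterval => (θ * (y : ℝ) + (1 - y))⁻¹ :=
  Continuous.inv₀ (by fun_prop) fun y => (mul_add_one_sub_pos hθ y).ne'

theorem integrable_inv_mul_add_one_sub (Q : Measure unitInterval) [IsFiniteMeasure Q] {θ : ℝ}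
    (hθ : 0 < θ) : Integrable (fun y : unitInterval => (θ * (y : ℝ) + (1 - y))⁻¹) Q :=
  (BoundedContinuousFunction.mkOfCompact ⟨_, continuous_inv_mul_add_one_sub hθ⟩).integrable Q

theorem IsStieltjes.congr {f g : ℝ → ℝ} (hf : IsStieltjes f) (h : ∀ θ, 0 < θ → g θ = f θ) :
    IsStieltjes g := by
  obtain ⟨Q, hQ, hf⟩ := hf
  exact ⟨Q, hQ, fun θ hθ => (h θ hθ).trans (hf θ hθ)⟩

theorem isStieltjes_inv_add {r : ℝ} (hr : 0 ≤ r) : IsStieltjes fun θ => (θ + r)⁻¹ := by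
  refine ⟨ENNReal.ofReal (1 + r)⁻¹ • Measure.dirac
    ⟨(1 + r)⁻¹, by positivity, inv_le_one_of_one_le₀ (by linarith)⟩,
    Measure.smul_finite _ ENNReal.ofReal_ne_top, fun θ _ => ?_⟩
  have hkernel : (1 + r) * (θ * (1 + r)⁻¹ + (1 - (1 + r)⁻¹)) = θ + r := by
    field_simp
    ring
  rw [integral_smul_measure, integral_dirac, ENNReal.toReal_ofReal (by positivity), smul_eq_mul,
    ← mul_inv, hkernel]

theorem IsStieltjes.const_mul {f : ℝ → ℝ} (hf : IsStieltjes f) {c : ℝ} (hc : 0 ≤ c) :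
    IsStieltjes fun θ => c * f θ := by
  obtain ⟨Q, hQ, hf⟩ := hf
  refine ⟨ENNReal.ofReal c • Q, Measure.smul_finite _ ENNReal.ofReal_ne_top, fun θ hθ => ?_⟩
  rw [integral_smul_measure, ENNReal.toReal_ofReal hc, ← hf θ hθ, smul_eq_mul]

theorem isStieltjes_sum {ι : Type*} (s : Finset ι) {f : ι → ℝ → ℝ}
    (h : ∀ i, IsStieltjes (f i)) : IsStieltjes fun θ => ∑ i ∈ s, f i θ := by
  choose Q hQ hf using h
  refine ⟨∑ i ∈ s, Q i, inferInstance, fun θ hθ => ?_⟩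
  rw [integral_finsetSum_measure fun i _ => integrable_inv_mul_add_one_sub (Q i) hθ]
  exact Finset.sum_congr rfl fun i _ => hf i θ hθ

theorem isStieltjes_of_tendsto {f : ℕ → ℝ → ℝ} {g : ℝ → ℝ} (hf : ∀ n, IsStieltjes (f n))
    (hlim : ∀ θ, 0 < θ → Tendsto (fun n => f n θ) atTop (𝓝 (g θ))) : IsStieltjes g := by
  choose Q hQ hf using hf
  obtain ⟨C, hC⟩ := (hlim 1 one_pos).bddAbove_range
  let q : ℕ → FiniteMeasure unitInterval := fun n => ⟨Q n, hQ n⟩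
  have hmass (n : ℕ) : (q n).mass ≤ C.toNNReal := by
    have hle : (Q n).real univ ≤ C := by
      have hvalue : (Q n).real univ = f n 1 := by simp [hf n 1 one_pos]
      exact hvalue.trans_le (hC (mem_range_self n))
    exact NNReal.le_toNNReal_of_coe_le hle
  obtain ⟨R, -, hR⟩ :=
    (isCompact_setOfPred_finiteMeasure_le_of_compactSpace unitInterval
      C.toNNReal).ultrafilter_le_nhds ((hyperfilter ℕ).map q)
      (le_principal_iff.2 (mem_map.2 (univ_mem' hmass)))
  refine ⟨R, inferInstance, fun θ hθ => ?_⟩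
  have hintegral := (FiniteMeasure.tendsto_iff_forall_integral_tendsto.1 hR)
    (BoundedContinuousFunction.mkOfCompact ⟨_, continuous_inv_mul_add_one_sub hθ⟩)
  exact tendsto_nhds_unique ((hlim θ hθ).mono_left Nat.hyperfilter_le_atTop)
    (hintegral.congr fun n => (hf n θ hθ).symm)

theorem isStieltjes_inner_resolvent {E : Type*} [NormedAddCommGroup E] [InnerProductSpace ℝ E]
    [FiniteDimensional ℝ E] {T : E →L[ℝ] E} (hT : T.IsPositive) (e : E) {v : ℝ → E}
    (hv : ∀ θ, 0 < θ → T (v θ) + θ • v θ = e) : IsStieltjes fun θ => inner ℝ e (v θ) := by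
  have hT := (ContinuousLinearMap.isPositive_toLinearMap_iff T).2 hT
  let b := hT.isSymmetric.eigenvectorBasis rfl
  let r := hT.isSymmetric.eigenvalues rfl
  have hr (i) : 0 ≤ r i := hT.nonneg_eigenvalues rfl i
  refine (isStieltjes_sum Finset.univ fun i =>
    (isStieltjes_inv_add (hr i)).const_mul (sq_nonneg (inner ℝ e (b i)))).congr fun θ hθ => ?_
  rw [← b.sum_inner_mul_inner]
  refine Finset.sum_congr rfl fun i _ => ?_
  have heigen : inner ℝ (b i) (T (v θ)) = r i * inner ℝ (b i) (v θ) := by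
    rw [← ContinuousLinearMap.coe_coe, ← hT.isSymmetric,
      hT.isSymmetric.apply_eigenvectorBasis rfl i, inner_smul_left]
    rfl
  have hcoord : inner ℝ e (b i) = (r i + θ) * inner ℝ (b i) (v θ) := by
    rw [real_inner_comm, ← hv θ hθ, inner_add_right, heigen, inner_smul_right, add_mul]
  have hpos : θ + r i ≠ 0 := (add_pos_of_pos_of_nonneg hθ (hr i)).ne'
  rw [hcoord]
  field_simp
  ring

open InnerProductSpace in
theorem isStieltjes_inner_of_smul_add_sum_smul {E : Type*} [NormedAddCommGroup E]
    [InnerProductSpace ℝ E] [FiniteDimensional ℝ E] {ι : Type*} [Fintype ι] {c : ℝ} (hc : 0 ≤ c)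
    {s : ι → ℝ} (hs : ∀ i, 0 ≤ s i) {e : E} {u : ι → E} {v : ℝ → E}
    (hv : ∀ θ, 0 < θ → (c * inner ℝ e (v θ)) • e + ∑ i, (s i * inner ℝ (u i) (v θ)) • u i +
      θ • v θ = e) : IsStieltjes fun θ => inner ℝ e (v θ) := by
  have hT : (c • rankOne ℝ e e + ∑ i, s i • rankOne ℝ (u i) (u i)).IsPositive :=
    ((isPositive_rankOne_self e).smul_of_nonneg hc).add <|
      ContinuousLinearMap.isPositive_sum _ fun i _ =>
        (isPositive_rankOne_self (u i)).smul_of_nonneg (hs i)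
  exact isStieltjes_inner_resolvent hT e fun θ hθ => by simpa [smul_smul] using hv θ hθ

theorem isStieltjes_inv_add_id_add_sum {ι : Type*} [Fintype ι] {c : ℝ} (hc : 0 ≤ c)
    {w s : ι → ℝ} (hw : ∀ i, 0 ≤ w i) (hs : ∀ i, 0 ≤ s i) :
    IsStieltjes fun θ => (c + θ + ∑ i, w i * (θ * s i / (θ + s i)))⁻¹ := by
  classical
  set G : ℝ → ℝ := fun θ => c + θ + ∑ i, w i * (θ * s i / (θ + s i))
  have hGpos (θ : ℝ) (hθ : 0 < θ) : 0 < G θ := by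
    have hsum : 0 ≤ ∑ i, w i * (θ * s i / (θ + s i)) := Finset.sum_nonneg fun i _ =>
      mul_nonneg (hw i) (div_nonneg (mul_nonneg hθ.le (hs i)) (add_nonneg hθ.le (hs i)))
    positivity
  let e : WithLp 2 (ℝ × EuclideanSpace ℝ ι) := WithLp.toLp 2 (1, 0)
  let u (i : ι) : WithLp 2 (ℝ × EuclideanSpace ℝ ι) :=
    WithLp.toLp 2 (√(w i), EuclideanSpace.single i 1)
  -- Block elimination: `v θ` solves the resolvent equation, and `G θ` is the Schur complement.
  let v (θ : ℝ) : WithLp 2 (ℝ × EuclideanSpace ℝ ι) :=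
    (G θ)⁻¹ • WithLp.toLp 2 (1, WithLp.toLp 2 fun i => -(√(w i) * s i / (θ + s i)))
  have he (θ : ℝ) : inner ℝ e (v θ) = (G θ)⁻¹ := by
    simp [e, v, WithLp.prod_inner_apply]
  have hu (θ : ℝ) (hθ : 0 < θ) (i : ι) :
      inner ℝ (u i) (v θ) = (G θ)⁻¹ * (√(w i) * θ / (θ + s i)) := by
    have hpos : θ + s i ≠ 0 := (add_pos_of_pos_of_nonneg hθ (hs i)).ne'
    have hsub : √(w i) - √(w i) * s i / (θ + s i) = √(w i) * θ / (θ + s i) := by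
      field_simp
      ring
    simp [u, v, WithLp.prod_inner_apply, inner_smul_right, EuclideanSpace.inner_single_left,
      ← sub_eq_add_neg, hsub]
  refine (isStieltjes_inner_of_smul_add_sum_smul hc hs (e := e) (u := u) (v := v)
    fun θ hθ => ?_).congr fun θ _ => (he θ).symm
  simp only [he, hu θ hθ, mul_left_comm _ (G θ)⁻¹, mul_smul (G θ)⁻¹, ← Finset.smul_sum,
    ← smul_add, mul_comm c]
  apply WithLp.ofLp_injective
  ext i
  · have hsum : ∑ i, s i * (√(w i) * θ / (θ + s i)) * √(w i) =
        ∑ i, w i * (θ * s i / (θ + s i)) := Finset.sum_congr rfl fun i _ => by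
      nth_rewrite 3 [← Real.mul_self_sqrt (hw i)]
      ring
    have hGsum : c + ∑ i, w i * (θ * s i / (θ + s i)) + θ = G θ := by ring
    simp only [e, u, v, Prod.fst_sum, hsum, WithLp.ofLp_add, WithLp.ofLp_smul, WithLp.ofLp_sum,
      Prod.fst_add, Prod.smul_fst, smul_eq_mul, mul_one]
    rw [mul_comm θ, ← mul_add, hGsum, inv_mul_cancel₀ (hGpos θ hθ).ne']
  · simp only [smul_add, WithLp.ofLp_add, WithLp.ofLp_smul, Prod.smul_mk, smul_eq_mul, mul_one,
      smul_zero, WithLp.ofLp_sum, Prod.snd_add, Prod.smul_snd, Prod.snd_sum, zero_add,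
      PiLp.add_apply, PiLp.smul_apply, PiLp.ofLp_single, Finset.sum_apply, Pi.smul_apply,
      Pi.single_apply, mul_ite, mul_zero, Finset.sum_ite_eq, Finset.mem_univ, ↓reduceIte, mul_neg,
      PiLp.zero_apply, e, u, v]
    ring

theorem isStieltjes_inv_add_mul_add_sum {ι : Type*} [Fintype ι] {c κ : ℝ} (hc : 0 ≤ c)
    (hκ : 0 < κ) {w s : ι → ℝ} (hw : ∀ i, 0 ≤ w i) (hs : ∀ i, 0 ≤ s i) :
    IsStieltjes fun θ => (c + κ * θ + ∑ i, w i * (θ * s i / (θ + s i)))⁻¹ := by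
  refine ((isStieltjes_inv_add_id_add_sum (div_nonneg hc hκ.le)
    (fun i => div_nonneg (hw i) hκ.le) hs).const_mul (inv_nonneg.2 hκ.le)).congr fun θ _ => ?_
  rw [← mul_inv, mul_add, mul_add, mul_div_cancel₀ _ hκ.ne', Finset.mul_sum]
  simp only [← mul_assoc, mul_div_cancel₀ _ hκ.ne']

end Stieltjes

section CompleteBernstein

theorem setIntegral_comp_lt {α : Type*} [MeasurableSpace α] {μ : Measure α} {f : α → ℕ}
    (hf : Measurable f) {g : ℕ → ℝ} (hg : Integrable (fun x => g (f x)) μ) (N : ℕ) :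
    ∫ x in {x | f x < N}, g (f x) ∂μ = ∑ k ∈ Finset.range N, μ.real (f ⁻¹' {k}) * g k := by
  have hcells : {x | f x < N} = ⋃ k ∈ Finset.range N, f ⁻¹' {k} := by
    ext x
    simp
  have hcell (k : ℕ) : MeasurableSet (f ⁻¹' {k}) := hf (measurableSet_singleton k)
  rw [hcells, integral_biUnion_finset _ (fun k _ => hcell k)
    (fun i _ j _ hij => (disjoint_singleton.2 hij).preimage f) fun k _ => hg.integrableOn]
  refine Finset.sum_congr rfl fun k _ => ?_
  rw [setIntegral_congr_fun (hcell k) (g := fun _ => g k) fun x hx => congrArg g hx,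
    setIntegral_const, smul_eq_mul]

theorem floor_mul_div_le (n : ℕ) {x : ℝ} (hx : 0 ≤ x) :
    (⌊((n : ℝ) + 1) * x⌋₊ : ℝ) / (n + 1) ≤ x := by
  rw [div_le_iff₀ (by positivity), mul_comm x]
  exact Nat.floor_le (by positivity)

theorem tendsto_floor_mul_div {x : ℝ} (hx : 0 ≤ x) :
    Tendsto (fun n : ℕ => (⌊((n : ℝ) + 1) * x⌋₊ : ℝ) / (n + 1)) atTop (𝓝 x) := by
  simpa [Function.comp_def, mul_comm] using (tendsto_nat_floor_mul_div_atTop (R := ℝ) hx).comp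
    (tendsto_natCast_atTop_atTop.atTop_add (tendsto_const_nhds (x := (1 : ℝ))))

theorem floor_mul_lt_sq {n : ℕ} {x : ℝ} (hx : x ≤ n) :
    ⌊((n : ℝ) + 1) * x⌋₊ < (n + 1) ^ 2 := by
  rw [Nat.floor_lt' (by positivity)]
  push_cast
  nlinarith

theorem tendsto_sum_measureReal_floor {U : Measure ℝ} (hpos : ∀ᵐ x ∂U, 0 < x) {h : ℝ → ℝ}
    (hint : Integrable h U) (hzero : 0 ≤ h 0) (hmono : MonotoneOn h (Ici 0))
    (hcont : ContinuousOn h (Ioi 0)) :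
    Tendsto (fun n : ℕ => ∑ k ∈ Finset.range ((n + 1) ^ 2),
      U.real ((fun x : ℝ => ⌊((n : ℝ) + 1) * x⌋₊) ⁻¹' {k}) * h (k / (n + 1))) atTop
      (𝓝 (∫ x, h x ∂U)) := by
  have hfloor (n : ℕ) : Measurable fun x : ℝ => ⌊((n : ℝ) + 1) * x⌋₊ := by fun_prop
  have hmeas (n : ℕ) : AEStronglyMeasurable
      (fun x : ℝ => h ((⌊((n : ℝ) + 1) * x⌋₊ : ℝ) / (n + 1))) U :=
    ((measurable_of_countable fun k : ℕ => h (k / (n + 1))).comp (hfloor n)).aestronglyMeasurable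
  have hbound (n : ℕ) : ∀ᵐ x ∂U, ‖h ((⌊((n : ℝ) + 1) * x⌋₊ : ℝ) / (n + 1))‖ ≤ h x := by
    filter_upwards [hpos] with x hx
    have hmem : 0 ≤ (⌊((n : ℝ) + 1) * x⌋₊ : ℝ) / (n + 1) := by positivity
    rw [Real.norm_of_nonneg (hzero.trans (hmono self_mem_Ici hmem hmem))]
    exact hmono hmem hx.le (floor_mul_div_le n hx.le)
  have hcell (n : ℕ) : MeasurableSet {x : ℝ | ⌊((n : ℝ) + 1) * x⌋₊ < (n + 1) ^ 2} :=
    measurableSet_lt (hfloor n) measurable_const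
  refine Tendsto.congr (fun n => (integral_indicator (hcell n)).trans <|
    setIntegral_comp_lt (hfloor n) (g := fun k => h (k / (n + 1)))
      (hint.mono' (hmeas n) (hbound n)) ((n + 1) ^ 2)) ?_
  refine tendsto_integral_of_dominated_convergence h (fun n => (hmeas n).indicator (hcell n)) hint
    (fun n => (hbound n).mono fun x hx => (norm_indicator_le_norm_self _ _).trans hx) ?_
  filter_upwards [hpos] with x hx
  refine ((hcont.continuousAt (Ioi_mem_nhds hx)).tendsto.comp
    (tendsto_floor_mul_div hx.le)).congr' ?_
  filter_upwards [eventually_ge_atTop ⌈x⌉₊] with n hn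
  have hlt : ⌊((n : ℝ) + 1) * x⌋₊ < (n + 1) ^ 2 := floor_mul_lt_sq (Nat.ceil_le.1 hn)
  exact (if_pos hlt).symm

variable {U : Measure ℝ} (hpos : ∀ᵐ x ∂U, 0 < x) (hint : Integrable (fun x => min 1 x) U)

theorem mul_div_add_le {θ x : ℝ} (hθ : 0 < θ) (hx : 0 ≤ x) :
    θ * x / (θ + x) ≤ (1 + θ) * min 1 x := by
  rw [div_le_iff₀ (by positivity)]
  rcases min_cases 1 x with ⟨hmin, _⟩ | ⟨hmin, _⟩ <;> rw [hmin]
  · nlinarith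
  · nlinarith [mul_nonneg hx hx, mul_nonneg hθ.le hx, mul_nonneg (mul_nonneg hθ.le hx) hθ.le,
      mul_nonneg (mul_nonneg hθ.le hx) hx]

theorem monotoneOn_mul_div_add {θ : ℝ} (hθ : 0 < θ) :
    MonotoneOn (fun x => θ * x / (θ + x)) (Ici 0) := by
  intro x hx y hy hxy
  rw [mem_Ici] at hx hy
  rw [div_le_div_iff₀ (by linarith) (by linarith)]
  nlinarith [mul_nonneg hθ.le hθ.le]

include hpos hint

theorem integrable_mul_div_add {θ : ℝ} (hθ : 0 < θ) :
    Integrable (fun x : ℝ => θ * x / (θ + x)) U := by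
  refine (hint.const_mul (1 + θ)).mono' (Measurable.aestronglyMeasurable (by fun_prop)) ?_
  filter_upwards [hpos] with x hx
  rw [Real.norm_of_nonneg (by positivity)]
  exact mul_div_add_le hθ hx.le

theorem isStieltjes_inv_add_mul_add_integral {c κ : ℝ} (hc : 0 < c) (hκ : 0 ≤ κ) :
    IsStieltjes fun θ => (c + κ * θ + ∫ x, θ * x / (θ + x) ∂U)⁻¹ := by
  refine isStieltjes_of_tendsto (f := fun n θ => (c + (κ + 1 / ((n : ℝ) + 1)) * θ +
    ∑ k ∈ Finset.range ((n + 1) ^ 2), U.real ((fun x : ℝ => ⌊((n : ℝ) + 1) * x⌋₊) ⁻¹' {k}) *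
      (θ * (k / (n + 1)) / (θ + k / (n + 1))))⁻¹) (fun n => ?_) fun θ hθ => ?_
  · simp only [Finset.sum_range]
    exact isStieltjes_inv_add_mul_add_sum hc.le (by positivity) (fun _ => measureReal_nonneg)
      fun _ => by positivity
  have hlinear : Tendsto (fun n : ℕ => c + (κ + 1 / ((n : ℝ) + 1)) * θ) atTop
      (𝓝 (c + κ * θ)) := by
    simpa using
      (((tendsto_one_div_add_atTop_nhds_zero_nat (𝕜 := ℝ)).const_add κ).mul_const θ).const_add c
  have hcont : ContinuousOn (fun x => θ * x / (θ + x)) (Ioi 0) :=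
    ContinuousOn.div (by fun_prop) (by fun_prop) fun x hx => (add_pos hθ hx).ne'
  have hnonneg : 0 ≤ ∫ x, θ * x / (θ + x) ∂U := integral_nonneg_of_ae <| by
    filter_upwards [hpos] with x hx
    exact div_nonneg (by positivity) (by positivity)
  refine (hlinear.add (tendsto_sum_measureReal_floor hpos (integrable_mul_div_add hpos hint hθ)
    (by simp) (monotoneOn_mul_div_add hθ) hcont)).inv₀ (ne_of_gt ?_)
  positivity

theorem sFinite_of_integrable_min_one : SFinite U := by
  have hfinite := isFiniteMeasure_withDensity_ofReal hint.2
  rw [← withDensity_inv_same (μ := U) (f := fun x => ENNReal.ofReal (min 1 x)) (by fun_prop)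
    (hpos.mono fun x hx => by simpa using hx) (ae_of_all _ fun x => ENNReal.ofReal_ne_top)]
  infer_instance

omit hpos hint

theorem integral_exp_neg_mul_Ioi {θ : ℝ} (hθ : 0 < θ) :
    ∫ x in Ioi (0 : ℝ), Real.exp (-θ * x) = 1 / θ := by
  rw [integral_exp_mul_Ioi (neg_neg_of_pos hθ)]
  simp

theorem integrableOn_exp_neg_mul_Ioi {θ : ℝ} (hθ : 0 < θ) :
    IntegrableOn (fun x => Real.exp (-θ * x)) (Ioi 0) :=
  integrableOn_exp_mul_Ioi (neg_neg_of_pos hθ) 0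

theorem integrableOn_exp_neg_mul_mul_id_Ioi {θ : ℝ} (hθ : 0 < θ) :
    IntegrableOn (fun x => Real.exp (-θ * x) * x) (Ioi 0) := by
  simpa [mul_comm] using integrableOn_rpow_mul_exp_neg_mul_rpow (p := 1) (s := 1) (b := θ)
    (by norm_num) one_pos hθ

theorem integral_exp_neg_mul_mul_id_Ioi {θ : ℝ} (hθ : 0 < θ) :
    ∫ x in Ioi (0 : ℝ), Real.exp (-θ * x) * x = 1 / θ ^ 2 := by
  have hgamma := Real.integral_rpow_mul_exp_neg_mul_Ioi (a := 2) (r := θ) two_pos hθ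
  rw [show (2 : ℝ) - 1 = 1 by norm_num] at hgamma
  simpa [mul_comm] using hgamma

theorem exp_neg_mul_mul_one_sub_exp (θ s x : ℝ) :
    Real.exp (-θ * x) * (1 - Real.exp (-x * s)) =
      Real.exp (-θ * x) - Real.exp (-(θ + s) * x) := by
  rw [mul_sub, mul_one, ← Real.exp_add]
  ring_nf

theorem integrableOn_exp_neg_mul_mul_one_sub_exp {θ s : ℝ} (hθ : 0 < θ) (hs : 0 < s) :
    IntegrableOn (fun x => Real.exp (-θ * x) * (1 - Real.exp (-x * s))) (Ioi 0) := by
  simp only [exp_neg_mul_mul_one_sub_exp]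
  exact (integrableOn_exp_neg_mul_Ioi hθ).sub (integrableOn_exp_neg_mul_Ioi (add_pos hθ hs))

theorem integral_exp_neg_mul_mul_one_sub_exp {θ s : ℝ} (hθ : 0 < θ) (hs : 0 < s) :
    ∫ x in Ioi 0, Real.exp (-θ * x) * (1 - Real.exp (-x * s)) = θ * s / (θ + s) / θ ^ 2 := by
  simp only [exp_neg_mul_mul_one_sub_exp]
  rw [integral_sub (integrableOn_exp_neg_mul_Ioi hθ)
    (integrableOn_exp_neg_mul_Ioi (add_pos hθ hs)), integral_exp_neg_mul_Ioi hθ,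
    integral_exp_neg_mul_Ioi (add_pos hθ hs)]
  field_simp
  ring

include hpos hint

theorem integrable_prod_exp_neg_mul_mul_one_sub_exp {θ : ℝ} (hθ : 0 < θ) :
    Integrable (Function.uncurry fun x s => Real.exp (-θ * x) * (1 - Real.exp (-x * s)))
      ((volume.restrict (Ioi (0 : ℝ))).prod U) := by
  have := sFinite_of_integrable_min_one hpos hint
  rw [integrable_prod_iff' (Measurable.aestronglyMeasurable (by fun_prop))]
  refine ⟨hpos.mono fun s hs => integrableOn_exp_neg_mul_mul_one_sub_exp hθ hs,
    ((integrable_mul_div_add hpos hint hθ).div_const (θ ^ 2)).congr ?_⟩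
  filter_upwards [hpos] with s hs
  rw [← integral_exp_neg_mul_mul_one_sub_exp hθ hs]
  refine setIntegral_congr_fun measurableSet_Ioi fun x hx => ?_
  have hexp : Real.exp (-x * s) ≤ 1 :=
    Real.exp_le_one_iff.2 (mul_nonpos_of_nonpos_of_nonneg (neg_nonpos.2 (le_of_lt hx)) hs.le)
  exact (Real.norm_of_nonneg (mul_nonneg (Real.exp_pos _).le (sub_nonneg.2 hexp))).symm

theorem integral_exp_neg_mul_mul_integral_one_sub_exp {θ : ℝ} (hθ : 0 < θ) :
    ∫ x in Ioi 0, Real.exp (-θ * x) * ∫ s, (1 - Real.exp (-x * s)) ∂U =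
      (∫ s, θ * s / (θ + s) ∂U) / θ ^ 2 := by
  have := sFinite_of_integrable_min_one hpos hint
  simp only [← integral_const_mul]
  rw [integral_integral_swap (integrable_prod_exp_neg_mul_mul_one_sub_exp hpos hint hθ),
    ← integral_div]
  exact integral_congr_ae (hpos.mono fun s hs => integral_exp_neg_mul_mul_one_sub_exp hθ hs)

theorem integrableOn_exp_neg_mul_mul_integral_one_sub_exp {θ : ℝ} (hθ : 0 < θ) :
    IntegrableOn (fun x => Real.exp (-θ * x) * ∫ s, (1 - Real.exp (-x * s)) ∂U) (Ioi 0) := by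
  have := sFinite_of_integrable_min_one hpos hint
  simp only [← integral_const_mul]
  exact (integrable_prod_exp_neg_mul_mul_one_sub_exp hpos hint hθ).integral_prod_left

omit hpos hint

theorem IsBernstein.exists_ae_pos {η : ℝ → ℝ} (hη : IsBernstein η) :
    ∃ (κ δ : ℝ) (U : Measure ℝ), 0 ≤ κ ∧ 0 ≤ δ ∧ (∀ᵐ x ∂U, 0 < x) ∧
      Integrable (fun x => min 1 x) U ∧
      ∀ θ, 0 ≤ θ → η θ = κ + δ * θ + ∫ x, (1 - Real.exp (-θ * x)) ∂U := by
  obtain ⟨κ, δ, U, hκ, hδ, hU, hfin, hη⟩ := hη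
  have hpos : ∀ᵐ x ∂U, 0 < x := by
    rw [ae_iff]
    simpa [Iic, not_lt] using hU
  refine ⟨κ, δ, U, hκ, hδ, hpos, ⟨by fun_prop, ?_⟩, hη⟩
  rwa [hasFiniteIntegral_iff_ofReal (hpos.mono fun x hx => le_min zero_le_one hx.le)]

theorem IsCompleteBernstein.exists_eq_add_mul_add_integral {φ : ℝ → ℝ}
    (hφ : IsCompleteBernstein φ) :
    ∃ (c κ : ℝ) (U : Measure ℝ), 0 ≤ c ∧ 0 ≤ κ ∧ (∀ᵐ x ∂U, 0 < x) ∧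
      Integrable (fun x => min 1 x) U ∧
      ∀ θ, 0 < θ → φ θ = c + κ * θ + ∫ x, θ * x / (θ + x) ∂U := by
  obtain ⟨η, hη, hφ⟩ := hφ
  obtain ⟨κ, δ, U, hκ, hδ, hpos, hint, hη⟩ := hη.exists_ae_pos
  refine ⟨δ, κ, U, hδ, hκ, hpos, hint, fun θ hθ => ?_⟩
  have hsplit : ∀ x ∈ Ioi (0 : ℝ), Real.exp (-θ * x) * η x =
      κ * Real.exp (-θ * x) + δ * (Real.exp (-θ * x) * x) +
        Real.exp (-θ * x) * ∫ s, (1 - Real.exp (-x * s)) ∂U := fun x hx => by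
    rw [hη x (le_of_lt hx)]
    ring
  have hconst := (integrableOn_exp_neg_mul_Ioi hθ).const_mul κ
  have hlinear := (integrableOn_exp_neg_mul_mul_id_Ioi hθ).const_mul δ
  have haffine : IntegrableOn
      (fun x => κ * Real.exp (-θ * x) + δ * (Real.exp (-θ * x) * x)) (Ioi 0) :=
    hconst.add hlinear
  rw [hφ θ hθ, setIntegral_congr_fun measurableSet_Ioi hsplit,
    integral_add haffine
      (integrableOn_exp_neg_mul_mul_integral_one_sub_exp hpos hint hθ),
    integral_add hconst hlinear, integral_const_mul, integral_const_mul,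
    integral_exp_neg_mul_Ioi hθ, integral_exp_neg_mul_mul_id_Ioi hθ,
    integral_exp_neg_mul_mul_integral_one_sub_exp hpos hint hθ]
  field_simp
  ring

theorem IsCompleteBernstein.isStieltjes_inv_add {φ : ℝ → ℝ} (hφ : IsCompleteBernstein φ) {c : ℝ}
    (hc : 0 < c) : IsStieltjes fun θ => (c + φ θ)⁻¹ := by
  obtain ⟨b, κ, U, hb, hκ, hpos, hint, hφ⟩ := hφ.exists_eq_add_mul_add_integral
  refine (isStieltjes_inv_add_mul_add_integral hpos hint (add_pos_of_pos_of_nonneg hc hb)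
    hκ).congr fun θ hθ => ?_
  rw [hφ θ hθ]
  ring

end CompleteBernstein

section LaplaceDensity

theorem IsStieltjes.exists_forall_mul_inv_le {g : ℝ → ℝ} (hg : IsStieltjes g) :
    ∃ Q : Measure unitInterval, IsFiniteMeasure Q ∧
      (∀ θ, 0 < θ → g θ = ∫ y : unitInterval, (θ * (y : ℝ) + (1 - y))⁻¹ ∂Q) ∧
      ∀ (y : unitInterval) (θ : ℝ), 0 < θ → Q.real {y} * (θ * (y : ℝ) + (1 - y))⁻¹ ≤ g θ := by
  obtain ⟨Q, hQ, hg⟩ := hg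
  refine ⟨Q, hQ, hg, fun y θ hθ => ?_⟩
  rw [hg θ hθ, ← smul_eq_mul,
    ← integral_singleton (μ := Q) (fun z : unitInterval => (θ * (z : ℝ) + (1 - z))⁻¹) y]
  exact setIntegral_le_integral (integrable_inv_mul_add_one_sub Q hθ)
    (ae_of_all _ fun z => inv_nonneg.2 (mul_add_one_sub_pos hθ z).le)

theorem IsStieltjes.exists_ae_mem_Ioo {g : ℝ → ℝ} (hg : IsStieltjes g)
    (hinf : ∀ ε > 0, ∃ θ, 0 < θ ∧ g θ < ε) {B : ℝ} (hB : ∀ θ, 0 < θ → g θ ≤ B) :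
    ∃ Q : Measure unitInterval, IsFiniteMeasure Q ∧
      (∀ θ, 0 < θ → g θ = ∫ y : unitInterval, (θ * (y : ℝ) + (1 - y))⁻¹ ∂Q) ∧
      ∀ᵐ y : unitInterval ∂Q, (y : ℝ) ∈ Ioo 0 1 := by
  obtain ⟨Q, hQ, hg, hatom⟩ := hg.exists_forall_mul_inv_le
  have hzero : Q {0} = 0 := by
    by_contra hne
    obtain ⟨θ, hθ, hlt⟩ := hinf (Q.real {0}) (ENNReal.toReal_pos hne (measure_ne_top Q _))
    have hle := hatom 0 θ hθ
    simp only [Icc.coe_zero, mul_zero, sub_zero, zero_add, inv_one, mul_one] at hle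
    exact hle.not_gt hlt
  have hone : Q {1} = 0 := by
    by_contra hne
    have hpos : 0 < Q.real {1} := ENNReal.toReal_pos hne (measure_ne_top Q _)
    have hθ : 0 < Q.real {1} / (|B| + 1) := by positivity
    have hle := (hatom 1 _ hθ).trans (hB _ hθ)
    simp only [Icc.coe_one, mul_one, sub_self, add_zero, inv_div] at hle
    rw [mul_div_cancel₀ _ hpos.ne'] at hle
    linarith [le_abs_self B]
  refine ⟨Q, hQ, hg, ?_⟩
  filter_upwards [compl_mem_ae_iff.2 hzero, compl_mem_ae_iff.2 hone] with y hy₀ hy₁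
  exact ⟨unitInterval.pos_iff_ne_zero.2 hy₀, unitInterval.lt_one_iff_ne_one.2 hy₁⟩

theorem IsStieltjes.exists_measure {g : ℝ → ℝ} (hg : IsStieltjes g)
    (hinf : ∀ ε > 0, ∃ θ, 0 < θ ∧ g θ < ε) {B : ℝ} (hB : ∀ θ, 0 < θ → g θ ≤ B) :
    ∃ m : Measure ℝ, SFinite m ∧ (∀ᵐ s ∂m, 0 < s) ∧ ∀ θ, 0 < θ →
      Integrable (fun s => (θ + s)⁻¹) m ∧ ∫ s, (θ + s)⁻¹ ∂m = g θ := by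
  obtain ⟨Q, hQ, hg, hIoo⟩ := hg.exists_ae_mem_Ioo hinf hB
  let T : unitInterval → ℝ := fun y => (1 - (y : ℝ)) / y
  let d : unitInterval → ℝ≥0 := fun y => ((y : ℝ)⁻¹).toNNReal
  have hT : Measurable T := by fun_prop
  have hd : Measurable d := by fun_prop
  have hkernel (θ : ℝ) :
      (fun y : unitInterval => (θ * (y : ℝ) + (1 - y))⁻¹) =ᵐ[Q] fun y => d y • (θ + T y)⁻¹ := by
    filter_upwards [hIoo] with y hy
    have hy₀ : 0 < (y : ℝ) := hy.1
    rw [NNReal.smul_def, Real.coe_toNNReal _ (by positivity), smul_eq_mul, ← mul_inv]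
    congr 1
    simp only [T]
    field_simp
  refine ⟨(Q.withDensity fun y => d y).map T, inferInstance, ?_, fun θ hθ => ⟨?_, ?_⟩⟩
  · rw [ae_map_iff hT.aemeasurable measurableSet_Ioi]
    refine (withDensity_absolutelyContinuous _ _).ae_le ?_
    filter_upwards [hIoo] with y hy
    exact div_pos (sub_pos.2 hy.2) hy.1
  · rw [integrable_map_measure (by fun_prop) hT.aemeasurable,
      integrable_withDensity_iff_integrable_smul hd]
    exact (integrable_inv_mul_add_one_sub Q hθ).congr (hkernel θ)
  · rw [integral_map hT.aemeasurable (by fun_prop), integral_withDensity_eq_integral_smul hd,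
      hg θ hθ]
    exact (integral_congr_ae (hkernel θ)).symm

/-- The Laplace transform `x ↦ ∫ exp (-s x) m(ds)` of a measure `m`, meant for measures on
`(0, ∞)`. -/
noncomputable def laplaceTransform (m : Measure ℝ) (x : ℝ) : ℝ := ∫ s, Real.exp (-(s * x)) ∂m

theorem exp_neg_mul_le_inv_mul_inv {a x s : ℝ} (ha : 0 < a) (hx : a ≤ x) (hs : 0 < s) :
    Real.exp (-(s * x)) ≤ a⁻¹ * (a⁻¹ + s)⁻¹ := by
  have hkernel : a⁻¹ * (a⁻¹ + s)⁻¹ = (s * a + 1)⁻¹ := by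
    field_simp
    rw [add_comm]
  rw [hkernel, Real.exp_neg]
  refine inv_anti₀ (by positivity) ((Real.add_one_le_exp (s * x)).trans' ?_)
  gcongr

variable {m : Measure ℝ}

theorem laplaceTransform_nonneg (x : ℝ) : 0 ≤ laplaceTransform m x :=
  integral_nonneg fun _ => (Real.exp_pos _).le

variable (hpos : ∀ᵐ s ∂m, 0 < s) (hm : ∀ θ, 0 < θ → Integrable (fun s => (θ + s)⁻¹) m)
include hpos

theorem ae_norm_exp_neg_mul_le {a x : ℝ} (ha : 0 < a) (hx : a ≤ x) :
    ∀ᵐ s ∂m, ‖Real.exp (-(s * x))‖ ≤ a⁻¹ * (a⁻¹ + s)⁻¹ := by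
  filter_upwards [hpos] with s hs
  rw [Real.norm_of_nonneg (Real.exp_pos _).le]
  exact exp_neg_mul_le_inv_mul_inv ha hx hs

include hm

theorem antitoneOn_laplaceTransform : AntitoneOn (laplaceTransform m) (Ioi 0) := by
  have hint : ∀ x : ℝ, 0 < x → Integrable (fun s => Real.exp (-(s * x))) m := fun x hx =>
    ((hm x⁻¹ (inv_pos.2 hx)).const_mul x⁻¹).mono' (by fun_prop)
      (ae_norm_exp_neg_mul_le hpos hx le_rfl)
  intro x hx y hy hxy
  refine integral_mono_ae (hint y hy) (hint x hx) ?_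
  filter_upwards [hpos] with s hs
  gcongr

theorem continuousOn_laplaceTransform : ContinuousOn (laplaceTransform m) (Ioi 0) := by
  intro x hx
  have hx' : 0 < x / 2 := half_pos hx
  refine ContinuousAt.continuousWithinAt (continuousAt_of_dominated
    (bound := fun s => (x / 2)⁻¹ * ((x / 2)⁻¹ + s)⁻¹)
    (Eventually.of_forall fun y => by fun_prop) ?_ ((hm _ (inv_pos.2 hx')).const_mul _)
    (ae_of_all _ fun s => by fun_prop))
  filter_upwards [Ioi_mem_nhds (half_lt_self hx)] with y hy
  exact ae_norm_exp_neg_mul_le hpos hx' (le_of_lt hy)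

theorem tendsto_laplaceTransform_atTop : Tendsto (laplaceTransform m) atTop (𝓝 0) := by
  have hlim : Tendsto (laplaceTransform m) atTop (𝓝 (∫ _, 0 ∂m)) :=
    tendsto_integral_filter_of_dominated_convergence
    (fun s => (1 : ℝ)⁻¹ * ((1 : ℝ)⁻¹ + s)⁻¹) (Eventually.of_forall fun x => by fun_prop)
    ((eventually_ge_atTop 1).mono fun x hx => ae_norm_exp_neg_mul_le hpos one_pos hx)
    ((hm _ (by positivity)).const_mul _)
    (hpos.mono fun s hs =>
      Real.tendsto_exp_neg_atTop_nhds_zero.comp (tendsto_id.const_mul_atTop hs))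
  simpa only [integral_zero] using hlim

variable [SFinite m]

theorem integrable_prod_exp_neg_mul_mul_exp_neg_mul {θ : ℝ} (hθ : 0 < θ) :
    Integrable (Function.uncurry fun x s => Real.exp (-θ * x) * Real.exp (-(s * x)))
      ((volume.restrict (Ioi (0 : ℝ))).prod m) := by
  have hexp (s x : ℝ) : Real.exp (-θ * x) * Real.exp (-(s * x)) = Real.exp (-(θ + s) * x) := by
    rw [← Real.exp_add]
    ring_nf
  rw [integrable_prod_iff' (Measurable.aestronglyMeasurable (by fun_prop))]
  simp only [Function.uncurry, hexp, Real.norm_eq_abs, Real.abs_exp]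
  refine ⟨?_, (hm θ hθ).congr ?_⟩
  · filter_upwards [hpos] with s hs
    exact integrableOn_exp_neg_mul_Ioi (add_pos hθ hs)
  · filter_upwards [hpos] with s hs
    rw [integral_exp_neg_mul_Ioi (add_pos hθ hs), one_div]

theorem integrableOn_exp_neg_mul_mul_laplaceTransform {θ : ℝ} (hθ : 0 < θ) :
    IntegrableOn (fun x => Real.exp (-θ * x) * laplaceTransform m x) (Ioi 0) := by
  simp only [laplaceTransform, ← integral_const_mul]
  exact (integrable_prod_exp_neg_mul_mul_exp_neg_mul hpos hm hθ).integral_prod_left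

theorem integral_exp_neg_mul_mul_laplaceTransform {θ : ℝ} (hθ : 0 < θ) :
    ∫ x in Ioi 0, Real.exp (-θ * x) * laplaceTransform m x = ∫ s, (θ + s)⁻¹ ∂m := by
  simp only [laplaceTransform, ← integral_const_mul]
  rw [integral_integral_swap (integrable_prod_exp_neg_mul_mul_exp_neg_mul hpos hm hθ)]
  refine integral_congr_ae ?_
  filter_upwards [hpos] with s hs
  have hexp (x : ℝ) : Real.exp (-θ * x) * Real.exp (-(s * x)) = Real.exp (-(θ + s) * x) := by
    rw [← Real.exp_add]
    ring_nf
  simp only [hexp]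
  rw [integral_exp_neg_mul_Ioi (add_pos hθ hs), one_div]

omit hpos hm [SFinite m]

theorem IsStieltjes.exists_laplace_density {g : ℝ → ℝ} (hg : IsStieltjes g)
    (hinf : ∀ ε > 0, ∃ θ, 0 < θ ∧ g θ < ε) {B : ℝ} (hB : ∀ θ, 0 < θ → g θ ≤ B) :
    ∃ u : ℝ → ℝ, (∀ x, 0 ≤ u x) ∧ AntitoneOn u (Ioi 0) ∧ ContinuousOn u (Ioi 0) ∧
      Tendsto u atTop (𝓝 0) ∧ ∀ θ, 0 < θ →
        IntegrableOn (fun x => Real.exp (-θ * x) * u x) (Ioi 0) ∧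
        ∫ x in Ioi 0, Real.exp (-θ * x) * u x = g θ := by
  obtain ⟨m, hsfinite, hpos, hm⟩ := hg.exists_measure hinf hB
  have hint : ∀ θ, 0 < θ → Integrable (fun s => (θ + s)⁻¹) m := fun θ hθ => (hm θ hθ).1
  exact ⟨laplaceTransform m, laplaceTransform_nonneg, antitoneOn_laplaceTransform hpos hint,
    continuousOn_laplaceTransform hpos hint, tendsto_laplaceTransform_atTop hpos hint,
    fun θ hθ => ⟨integrableOn_exp_neg_mul_mul_laplaceTransform hpos hint hθ,
      (integral_exp_neg_mul_mul_laplaceTransform hpos hint hθ).trans (hm θ hθ).2⟩⟩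

end LaplaceDensity

section PoissonPoints

theorem integral_finset_prod_infinitePi {ι : Type*} {Ω : ι → Type*}
    [∀ i, MeasurableSpace (Ω i)] (P : ∀ i, Measure (Ω i)) [∀ i, IsProbabilityMeasure (P i)]
    (s : Finset ι) {f : ∀ i, Ω i → ℂ} (hf : ∀ i, Measurable (f i)) :
    ∫ ω, ∏ i ∈ s, f i (ω i) ∂(Measure.infinitePi P) = ∏ i ∈ s, ∫ x, f i x ∂(P i) := by
  have hindep := (iIndepFun_infinitePi (P := P) (X := f) hf).precomp
    (g := ((↑) : s → ι)) Subtype.val_injective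
  have hprod := hindep.integral_fun_prod_eq_prod_integral fun i =>
    ((hf i).comp (measurable_pi_apply (i : ι))).aestronglyMeasurable
  have heval : ∀ i, ∫ ω, f i (ω i) ∂(Measure.infinitePi P) = ∫ x, f i x ∂(P i) := fun i => by
    have h := measurePreserving_eval_infinitePi P i
    rw [← h.map_eq, integral_map h.measurable.aemeasurable (hf i).aestronglyMeasurable]
  simpa only [← heval, ← Finset.prod_coe_sort s] using hprod

theorem norm_exp_sub_one_le_two_mul_min {z : ℂ} (hz : z.re ≤ 0) :
    ‖Complex.exp z - 1‖ ≤ 2 * min 1 ‖z‖ := by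
  rcases le_total ‖z‖ 1 with h | h
  · rw [min_eq_right h]
    exact Complex.norm_exp_sub_one_le h
  · rw [min_eq_left h]
    refine (norm_sub_le _ _).trans ?_
    rw [Complex.norm_exp, norm_one]
    linarith [Real.exp_le_one_iff.2 hz]

theorem integrable_exp_sub_one {E : Type*} [MeasurableSpace E] {μ : Measure E} {w : E → ℂ}
    (hw : Measurable w) (hre : ∀ x, (w x).re ≤ 0)
    (hint : Integrable (fun x => min 1 ‖w x‖) μ) :
    Integrable (fun x => Complex.exp (w x) - 1) μ :=
  (hint.const_mul 2).mono' (Measurable.aestronglyMeasurable (by fun_prop))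
    (ae_of_all _ fun x => norm_exp_sub_one_le_two_mul_min (hre x))

theorem lintegral_natCast_poissonMeasure_one_lt_top :
    ∫⁻ n : ℕ, (n : ℝ≥0∞) ∂(poissonMeasure 1) < ∞ := by
  have hint : Integrable (fun n : ℕ => (n : ℝ)) (poissonMeasure 1) := by
    rw [integrable_poissonMeasure_iff, ← summable_nat_add_iff 1]
    refine ((Real.summable_pow_div_factorial 1).mul_left (Real.exp (-1))).congr fun n => ?_
    rw [Nat.factorial_succ]
    simp only [NNReal.coe_one, one_pow, mul_one, Real.norm_natCast]
    push_cast
    field_simp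
  simpa [hasFiniteIntegral_iff_ofReal (ae_of_all _ fun n : ℕ => (Nat.cast_nonneg n : (0 : ℝ) ≤ n))]
    using hint.2

theorem integral_pow_poissonMeasure_one (a : ℂ) :
    ∫ n : ℕ, a ^ n ∂(poissonMeasure 1) = Complex.exp (a - 1) := by
  have hexp : ∑' n : ℕ, a ^ n / (n.factorial : ℂ) = Complex.exp a := by
    rw [Complex.exp_eq_exp_ℂ, NormedSpace.exp_eq_tsum_div]
  rw [integral_poissonMeasure, Complex.exp_sub, ← hexp, ← tsum_div_const]
  refine tsum_congr fun n => ?_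
  rw [Complex.real_smul]
  simp only [NNReal.coe_one, one_pow, mul_one]
  push_cast
  rw [Complex.exp_neg]
  field_simp

variable {ι E M : Type*}

/-- A family of finite point configurations in `E` indexed by cells: each cell carries its number
of points and a sequence whose initial segment of that length lists them. -/
abbrev PoissonConfiguration (ι E : Type*) : Type _ := ι → ℕ × (ℕ → E)

/-- The sum of `f` over the points of one cell. -/
def cellSum [AddCommMonoid M] (f : E → M) (p : ℕ × (ℕ → E)) : M :=
  ∑ k ∈ Finset.range p.1, f (p.2 k)

/-- The sum of `f` over all points of a configuration, with the junk value `0` when the cell sums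
are not summable. -/
noncomputable def pointSum [AddCommMonoid M] [TopologicalSpace M] (f : E → M)
    (ω : PoissonConfiguration ι E) : M :=
  ∑' c, cellSum f (ω c)

theorem norm_cellSum_le (w : E → ℂ) (p : ℕ × (ℕ → E)) :
    ‖cellSum w p‖ ≤ cellSum (fun x => ‖w x‖) p :=
  norm_sum_le _ _

theorem re_cellSum_nonpos {w : E → ℂ} (hre : ∀ x, (w x).re ≤ 0) (p : ℕ × (ℕ → E)) :
    (cellSum w p).re ≤ 0 := by
  rw [cellSum, Complex.re_sum]
  exact Finset.sum_nonpos fun k _ => hre _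

theorem toReal_cellSum_min_one {h : E → ℝ} (h0 : ∀ x, 0 ≤ h x) {p : ℕ × (ℕ → E)}
    (hp : cellSum (fun x => ENNReal.ofReal (min 1 (h x))) p < 1) :
    (cellSum (fun x => ENNReal.ofReal (min 1 (h x))) p).toReal = cellSum h p := by
  simp only [cellSum] at hp ⊢
  rw [ENNReal.toReal_sum fun k _ => ENNReal.ofReal_ne_top]
  refine Finset.sum_congr rfl fun k hk => ?_
  have hk_lt : ENNReal.ofReal (min 1 (h (p.2 k))) < 1 :=
    (Finset.single_le_sum (f := fun k => ENNReal.ofReal (min 1 (h (p.2 k))))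
      (fun _ _ => zero_le) hk).trans_lt hp
  rw [ENNReal.ofReal_lt_one, min_lt_iff] at hk_lt
  rw [min_eq_right (hk_lt.resolve_left (lt_irrefl _)).le, ENNReal.toReal_ofReal (h0 _)]

variable [MeasurableSpace E]

/-- The law of independent finite Poisson point processes: cell `c` contains a Poisson number, of
mean one, of independent points with distribution `κ c`. -/
noncomputable def poissonPointLaw (κ : ι → Measure E) : Measure (PoissonConfiguration ι E) :=
  Measure.infinitePi fun c => (poissonMeasure 1).prod (Measure.infinitePi fun _ : ℕ => κ c)

instance (κ : ι → Measure E) [∀ c, IsProbabilityMeasure (κ c)] :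
    IsProbabilityMeasure (poissonPointLaw κ) := by
  unfold poissonPointLaw; infer_instance

section Measurability

variable [AddCommMonoid M] [MeasurableSpace M] [MeasurableAdd₂ M]

theorem measurable_cellSum {f : E → M} (hf : Measurable f) : Measurable (cellSum f) :=
  measurable_from_prod_countable_right fun n =>
    Finset.measurable_fun_sum (Finset.range n) (f := fun k (y : ℕ → E) => f (y k))
      fun k _ => hf.comp (measurable_pi_apply k)

theorem measurable_cellSum_apply {f : E → M} (hf : Measurable f) (c : ι) :
    Measurable fun ω : PoissonConfiguration ι E => cellSum f (ω c) :=
  (measurable_cellSum hf).comp (measurable_pi_apply c)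

end Measurability

theorem measurable_pointSum [Countable ι] {f : E → ℝ} (hf : Measurable f) :
    Measurable (pointSum f : PoissonConfiguration ι E → ℝ) :=
  Measurable.tsum fun c => measurable_cellSum_apply hf c

theorem integral_exp_sum_range (κ : Measure E) [IsProbabilityMeasure κ] {w : E → ℂ}
    (hw : Measurable w) (n : ℕ) :
    ∫ y : ℕ → E, Complex.exp (∑ k ∈ Finset.range n, w (y k))
      ∂(Measure.infinitePi fun _ : ℕ => κ) = (∫ x, Complex.exp (w x) ∂κ) ^ n := by
  simp only [Complex.exp_sum]
  rw [integral_finset_prod_infinitePi (fun _ : ℕ => κ) (Finset.range n)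
    (f := fun _ x => Complex.exp (w x)) (fun _ => by fun_prop)]
  simp

theorem integral_exp_cellSum (κ : Measure E) [IsProbabilityMeasure κ] {w : E → ℂ}
    (hw : Measurable w) (hre : ∀ x, (w x).re ≤ 0) :
    ∫ p, Complex.exp (cellSum w p)
      ∂((poissonMeasure 1).prod (Measure.infinitePi fun _ : ℕ => κ)) =
      Complex.exp (∫ x, (Complex.exp (w x) - 1) ∂κ) := by
  have hint : Integrable (fun x => Complex.exp (w x)) κ :=
    Integrable.of_bound (C := 1) (by fun_prop) (ae_of_all _ fun x => by
      rw [Complex.norm_exp]; exact Real.exp_le_one_iff.2 (hre x))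
  rw [integral_prod]
  · simp only [cellSum, integral_exp_sum_range κ hw]
    rw [integral_pow_poissonMeasure_one, integral_sub hint (integrable_const 1)]
    simp
  · refine Integrable.of_bound (C := 1)
      (Complex.measurable_exp.comp (measurable_cellSum hw)).aestronglyMeasurable
      (ae_of_all _ fun p => ?_)
    rw [Complex.norm_exp]
    exact Real.exp_le_one_iff.2 (re_cellSum_nonpos hre p)

theorem lintegral_cellSum (κ : Measure E) [IsProbabilityMeasure κ] {f : E → ℝ≥0∞}
    (hf : Measurable f) :
    ∫⁻ p, cellSum f p ∂((poissonMeasure 1).prod (Measure.infinitePi fun _ : ℕ => κ)) =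
      (∫⁻ n : ℕ, (n : ℝ≥0∞) ∂(poissonMeasure 1)) * ∫⁻ x, f x ∂κ := by
  rw [lintegral_prod _ (measurable_cellSum hf).aemeasurable,
    ← lintegral_mul_const _ (by fun_prop)]
  refine lintegral_congr fun n => ?_
  simp only [cellSum]
  rw [lintegral_finsetSum _ fun k _ =>
    show Measurable fun y : ℕ → E => f (y k) from hf.comp (measurable_pi_apply k)]
  have heval : ∀ k : ℕ, ∫⁻ y : ℕ → E, f (y k) ∂(Measure.infinitePi fun _ : ℕ => κ) =
      ∫⁻ x, f x ∂κ :=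
    fun k => (measurePreserving_eval_infinitePi (fun _ : ℕ => κ) k).lintegral_comp hf
  simp [heval]

variable {κ : ι → Measure E} [∀ c, IsProbabilityMeasure (κ c)]

theorem integral_exp_sum_cellSum {w : E → ℂ} (hw : Measurable w) (hre : ∀ x, (w x).re ≤ 0)
    (s : Finset ι) :
    ∫ ω, Complex.exp (∑ c ∈ s, cellSum w (ω c)) ∂(poissonPointLaw κ) =
      Complex.exp (∑ c ∈ s, ∫ x, (Complex.exp (w x) - 1) ∂(κ c)) := by
  simp only [Complex.exp_sum, poissonPointLaw]
  rw [integral_finset_prod_infinitePi _ s (f := fun _ p => Complex.exp (cellSum w p))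
    (fun _ => Complex.measurable_exp.comp (measurable_cellSum hw))]
  exact Finset.prod_congr rfl fun c _ => integral_exp_cellSum (κ c) hw hre

variable [Countable ι]

theorem lintegral_tsum_cellSum {f : E → ℝ≥0∞} (hf : Measurable f) :
    ∫⁻ ω, ∑' c, cellSum f (ω c) ∂(poissonPointLaw κ) =
      (∫⁻ n : ℕ, (n : ℝ≥0∞) ∂(poissonMeasure 1)) * ∫⁻ x, f x ∂(Measure.sum κ) := by
  rw [lintegral_tsum fun c => (measurable_cellSum_apply hf c).aemeasurable,
    lintegral_sum_measure, ← ENNReal.tsum_mul_left]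
  refine tsum_congr fun c => ?_
  rw [← lintegral_cellSum (κ c) hf]
  exact (measurePreserving_eval_infinitePi (fun c => (poissonMeasure 1).prod
    (Measure.infinitePi fun _ : ℕ => κ c)) c).lintegral_comp (measurable_cellSum hf)

theorem ae_summable_cellSum {h : E → ℝ} (hm : Measurable h) (h0 : ∀ x, 0 ≤ h x)
    (hint : Integrable (fun x => min 1 (h x)) (Measure.sum κ)) :
    ∀ᵐ ω ∂(poissonPointLaw κ), Summable fun c => cellSum h (ω c) := by
  set f : E → ℝ≥0∞ := fun x => ENNReal.ofReal (min 1 (h x))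
  have hfm : Measurable f := by fun_prop
  have hfin : ∫⁻ ω, ∑' c, cellSum f (ω c) ∂(poissonPointLaw κ) ≠ ∞ := by
    rw [lintegral_tsum_cellSum hfm]
    exact ENNReal.mul_ne_top lintegral_natCast_poissonMeasure_one_lt_top.ne
      ((hasFiniteIntegral_iff_ofReal
        (ae_of_all _ fun x => le_min zero_le_one (h0 x))).1 hint.2).ne
  filter_upwards [ae_lt_top (Measurable.tsum fun c => measurable_cellSum_apply hfm c) hfin]
    with ω hω
  refine (summable_congr_cofinite ?_).1 (ENNReal.summable_toReal hω.ne)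
  filter_upwards [(ENNReal.tendsto_cofinite_zero_of_tsum_ne_top hω.ne).eventually_lt_const
    one_pos] with c hc
  exact toReal_cellSum_min_one h0 hc

theorem integral_exp_pointSum {w : E → ℂ} (hw : Measurable w) (hre : ∀ x, (w x).re ≤ 0)
    (hint : Integrable (fun x => min 1 ‖w x‖) (Measure.sum κ)) :
    ∫ ω, Complex.exp (pointSum w ω) ∂(poissonPointLaw κ) =
      Complex.exp (∫ x, (Complex.exp (w x) - 1) ∂(Measure.sum κ)) := by
  have hlim_exponent : Tendsto (fun s : Finset ι => Complex.exp
      (∑ c ∈ s, ∫ x, (Complex.exp (w x) - 1) ∂(κ c))) atTop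
      (𝓝 (Complex.exp (∫ x, (Complex.exp (w x) - 1) ∂(Measure.sum κ)))) :=
    (Complex.continuous_exp.tendsto _).comp
      (hasSum_integral_measure (integrable_exp_sub_one hw hre hint))
  have hlim_integral : Tendsto (fun s : Finset ι =>
      ∫ ω, Complex.exp (∑ c ∈ s, cellSum w (ω c)) ∂(poissonPointLaw κ)) atTop
      (𝓝 (∫ ω, Complex.exp (pointSum w ω) ∂(poissonPointLaw κ))) := by
    refine tendsto_integral_filter_of_dominated_convergence (fun _ => 1)
      (Eventually.of_forall fun s => ?_) (Eventually.of_forall fun s => ae_of_all _ fun ω => ?_)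
      (integrable_const _) ?_
    · exact (Complex.measurable_exp.comp (Finset.measurable_fun_sum s fun c _ =>
        measurable_cellSum_apply hw c)).aestronglyMeasurable
    · rw [Complex.norm_exp, Real.exp_le_one_iff, Complex.re_sum]
      exact Finset.sum_nonpos fun c _ => re_cellSum_nonpos hre _
    · filter_upwards [ae_summable_cellSum hw.norm (fun _ => norm_nonneg _) hint] with ω hω
      have hsummable : Summable fun c => cellSum w (ω c) :=
        Summable.of_norm_bounded hω fun c => norm_cellSum_le w _
      exact (Complex.continuous_exp.tendsto _).comp hsummable.hasSum
  simp only [integral_exp_sum_cellSum hw hre] at hlim_integral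
  exact tendsto_nhds_unique hlim_integral hlim_exponent

end PoissonPoints

section UnitCell

/-- The uniform distribution on the unit square with lower left corner `c`. -/
noncomputable def unitCell (c : ℤ × ℤ) : Measure (ℝ × ℝ) :=
  (volume.restrict (Ioc (c.1 : ℝ) (c.1 + 1))).prod (volume.restrict (Ioc (c.2 : ℝ) (c.2 + 1)))

instance (c : ℤ × ℤ) : IsProbabilityMeasure (unitCell c) := by
  have h : ∀ a : ℤ, IsProbabilityMeasure (volume.restrict (Ioc (a : ℝ) (a + 1))) := fun a =>
    ⟨by simp⟩
  have := h c.1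
  have := h c.2
  unfold unitCell
  infer_instance

theorem sum_unitCell : Measure.sum unitCell = (volume : Measure ℝ).prod volume := by
  have h : Measure.sum (fun a : ℤ => volume.restrict (Ioc (a : ℝ) (a + 1))) = volume := by
    rw [← Measure.restrict_iUnion (pairwise_disjoint_Ioc_intCast ℝ) fun _ => measurableSet_Ioc,
      iUnion_Ioc_intCast, Measure.restrict_univ]
  have hprod := Measure.prod_sum (fun a : ℤ => volume.restrict (Ioc (a : ℝ) (a + 1)))
    (fun a : ℤ => volume.restrict (Ioc (a : ℝ) (a + 1)))
  rw [h] at hprod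
  exact hprod.symm

end UnitCell

theorem min_one_mul_le {C r : ℝ} (hC : 0 ≤ C) (hr : 0 ≤ r) :
    min 1 (C * r) ≤ (1 + C) * min 1 r := by
  rcases min_cases 1 r with ⟨h, _⟩ | ⟨h, _⟩ <;> rw [h]
  · exact (min_le_left _ _).trans (by linarith)
  · exact (min_le_right _ _).trans (by nlinarith)

section Jump

/-- The size `g y` of the jump that the point `(s, y)` stands for, counted only if its time `s`
belongs to `A`. -/
noncomputable def jump (g : ℝ → ℝ) (A : Set ℝ) (p : ℝ × ℝ) : ℝ :=
  A.indicator (fun _ => 1) p.1 * g p.2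

variable {g : ℝ → ℝ}

theorem measurable_jump (hg : Measurable g) {A : Set ℝ} (hA : MeasurableSet A) :
    Measurable (jump g A) := by
  have : Measurable (A.indicator fun _ => (1 : ℝ)) := measurable_const.indicator hA
  unfold jump
  fun_prop

theorem jump_union {A B : Set ℝ} (hAB : Disjoint A B) (p : ℝ × ℝ) :
    jump g (A ∪ B) p = jump g A p + jump g B p := by
  simp only [jump, indicator_union_of_disjoint hAB, add_mul]

section Nonneg

variable (h0 : ∀ y, 0 ≤ g y)
include h0

theorem jump_nonneg (A : Set ℝ) (p : ℝ × ℝ) : 0 ≤ jump g A p :=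
  mul_nonneg (indicator_nonneg (fun _ _ => zero_le_one) _) (h0 _)

theorem jump_mono {A B : Set ℝ} (hAB : A ⊆ B) (p : ℝ × ℝ) : jump g A p ≤ jump g B p :=
  mul_le_mul_of_nonneg_right
    (indicator_le_indicator_of_subset hAB (fun _ => zero_le_one) _) (h0 _)

theorem cellSum_jump_nonneg (A : Set ℝ) (p : ℕ × (ℕ → ℝ × ℝ)) : 0 ≤ cellSum (jump g A) p :=
  Finset.sum_nonneg fun _ _ => jump_nonneg h0 _ _

theorem cellSum_jump_mono {A B : Set ℝ} (hAB : A ⊆ B) (p : ℕ × (ℕ → ℝ × ℝ)) :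
    cellSum (jump g A) p ≤ cellSum (jump g B) p :=
  Finset.sum_le_sum fun _ _ => jump_mono h0 hAB _

theorem summable_cellSum_jump_of_subset {A B : Set ℝ} (hAB : A ⊆ B)
    {ω : PoissonConfiguration (ℤ × ℤ) (ℝ × ℝ)}
    (h : Summable fun c => cellSum (jump g B) (ω c)) :
    Summable fun c => cellSum (jump g A) (ω c) :=
  h.of_nonneg_of_le (fun _ => cellSum_jump_nonneg h0 _ _) fun _ => cellSum_jump_mono h0 hAB _

theorem norm_sum_mul_jump_le {n : ℕ} (A : Fin n → Set ℝ) (z : Fin n → ℂ) (p : ℝ × ℝ) :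
    ‖∑ i, z i * (jump g (A i) p : ℂ)‖ ≤ (∑ i, ‖z i‖) * jump g (⋃ i, A i) p := by
  rw [Finset.sum_mul]
  refine (norm_sum_le _ _).trans (Finset.sum_le_sum fun i _ => ?_)
  rw [norm_mul, Complex.norm_of_nonneg (jump_nonneg h0 _ _)]
  exact mul_le_mul_of_nonneg_left (jump_mono h0 (subset_iUnion A i) p) (norm_nonneg _)

theorem re_sum_mul_jump_nonpos {n : ℕ} (A : Fin n → Set ℝ) {z : Fin n → ℂ}
    (hz : ∀ i, (z i).re ≤ 0) (p : ℝ × ℝ) : (∑ i, z i * (jump g (A i) p : ℂ)).re ≤ 0 := by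
  simp only [Complex.re_sum, Complex.re_mul_ofReal]
  exact Finset.sum_nonpos fun i _ => mul_nonpos_of_nonpos_of_nonneg (hz i) (jump_nonneg h0 _ _)

end Nonneg

theorem exp_sum_mul_jump_sub_one {n : ℕ} {A : Fin n → Set ℝ}
    (hdisj : Pairwise fun i j => Disjoint (A i) (A j)) (z : Fin n → ℂ) (p : ℝ × ℝ) :
    Complex.exp (∑ i, z i * (jump g (A i) p : ℂ)) - 1 =
      ∑ i, (A i).indicator (fun _ => (1 : ℂ)) p.1 * (Complex.exp (z i * g p.2) - 1) := by
  simp only [jump]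
  by_cases hp : ∃ i, p.1 ∈ A i
  · obtain ⟨i, hi⟩ := hp
    have hne : ∀ j, j ≠ i → p.1 ∉ A j := fun j hj hpj => Set.disjoint_left.1 (hdisj hj) hpj hi
    rw [Finset.sum_eq_single i (fun j _ hj => by simp [hne j hj]) (by simp),
      Finset.sum_eq_single i (fun j _ hj => by simp [hne j hj]) (by simp)]
    simp [hi]
  · push Not at hp
    simp [hp]

theorem pointSum_sum_mul_jump {n : ℕ} {A : Fin n → Set ℝ} (z : Fin n → ℂ)
    {ω : PoissonConfiguration (ℤ × ℤ) (ℝ × ℝ)}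
    (h : ∀ i, Summable fun c => cellSum (jump g (A i)) (ω c)) :
    pointSum (fun p => ∑ i, z i * (jump g (A i) p : ℂ)) ω =
      ∑ i, z i * (pointSum (jump g (A i)) ω : ℝ) := by
  have hsum : HasSum (fun c => ∑ i, z i * (cellSum (jump g (A i)) (ω c) : ℝ))
      (∑ i, z i * (pointSum (jump g (A i)) ω : ℝ)) :=
    hasSum_sum fun i _ => (Complex.hasSum_ofReal.2 (h i).hasSum).mul_left (z i)
  rw [← hsum.tsum_eq, pointSum]
  refine tsum_congr fun c => ?_
  simp only [cellSum]
  rw [Finset.sum_comm]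
  exact Finset.sum_congr rfl fun i _ => by rw [← Finset.mul_sum, Complex.ofReal_sum]

section Integrable

variable (hg : Measurable g) (h0 : ∀ y, 0 ≤ g y) (hint : Integrable fun y => min 1 (g y))
include hg h0 hint

theorem integrable_exp_mul_sub_one {z : ℂ} (hz : z.re ≤ 0) :
    Integrable fun y => Complex.exp (z * g y) - 1 := by
  refine integrable_exp_sub_one (by fun_prop) (fun y => ?_) ?_
  · rw [Complex.re_mul_ofReal]
    exact mul_nonpos_of_nonpos_of_nonneg hz (h0 y)
  · refine (hint.const_mul (1 + ‖z‖)).mono' (Measurable.aestronglyMeasurable (by fun_prop))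
      (ae_of_all _ fun y => ?_)
    rw [Real.norm_of_nonneg (le_min zero_le_one (norm_nonneg _)), norm_mul,
      Complex.norm_of_nonneg (h0 y)]
    exact min_one_mul_le (norm_nonneg z) (h0 y)

omit hg h0 in
theorem integrable_min_one_jump {A : Set ℝ} (hA : MeasurableSet A) (hAfin : volume A ≠ ∞) :
    Integrable (fun p => min 1 (jump g A p)) (Measure.sum unitCell) := by
  have hind : Integrable (A.indicator fun _ => (1 : ℝ)) :=
    (integrable_indicator_iff hA).2 (integrableOn_const hAfin)
  rw [sum_unitCell]
  refine (hind.mul_prod hint).congr (ae_of_all _ fun p => ?_)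
  by_cases hp : p.1 ∈ A <;> simp [jump, hp]

theorem ae_summable_cellSum_jump {A : Set ℝ} (hA : MeasurableSet A) (hAfin : volume A ≠ ∞) :
    ∀ᵐ ω ∂(poissonPointLaw unitCell), Summable fun c => cellSum (jump g A) (ω c) :=
  ae_summable_cellSum (measurable_jump hg hA) (jump_nonneg h0 _)
    (integrable_min_one_jump hint hA hAfin)

variable {n : ℕ} {A : Fin n → Set ℝ} (hA : ∀ i, MeasurableSet (A i))
  (hAfin : ∀ i, volume (A i) ≠ ∞) {z : Fin n → ℂ} (hz : ∀ i, (z i).re ≤ 0)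
include hA hAfin

theorem integrable_min_one_norm_sum_mul_jump (z : Fin n → ℂ) :
    Integrable (fun p => min 1 ‖∑ i, z i * (jump g (A i) p : ℂ)‖) (Measure.sum unitCell) := by
  have hUnion : volume (⋃ i, A i) ≠ ∞ :=
    ((measure_iUnion_fintype_le _ _).trans_lt (ENNReal.sum_lt_top.2 fun i _ =>
      (hAfin i).lt_top)).ne
  have hw : Measurable fun p => ∑ i, z i * (jump g (A i) p : ℂ) :=
    Finset.measurable_fun_sum _ fun i _ =>
      (Complex.measurable_ofReal.comp (measurable_jump hg (hA i))).const_mul _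
  refine ((integrable_min_one_jump hint (MeasurableSet.iUnion hA) hUnion).const_mul
    (1 + ∑ i, ‖z i‖)).mono' (measurable_const.min hw.norm).aestronglyMeasurable
    (ae_of_all _ fun p => ?_)
  rw [Real.norm_of_nonneg (le_min zero_le_one (norm_nonneg _))]
  exact (min_le_min_left 1 (norm_sum_mul_jump_le h0 A z p)).trans
    (min_one_mul_le (Finset.sum_nonneg fun i _ => norm_nonneg _) (jump_nonneg h0 _ _))

variable (hdisj : Pairwise fun i j => Disjoint (A i) (A j))
include hdisj hz

theorem integral_exp_sum_mul_jump_sub_one :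
    ∫ p, (Complex.exp (∑ i, z i * (jump g (A i) p : ℂ)) - 1) ∂(Measure.sum unitCell) =
      ∑ i, volume.real (A i) * ∫ y, (Complex.exp (z i * g y) - 1) := by
  have hind : ∀ i, Integrable ((A i).indicator fun _ => (1 : ℂ)) := fun i =>
    (integrable_indicator_iff (hA i)).2 (integrableOn_const (hAfin i))
  simp only [exp_sum_mul_jump_sub_one hdisj, sum_unitCell]
  rw [integral_finsetSum _ fun i _ =>
    (hind i).mul_prod (integrable_exp_mul_sub_one hg h0 hint (hz i))]
  refine Finset.sum_congr rfl fun i _ => ?_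
  rw [integral_prod_mul ((A i).indicator fun _ => (1 : ℂ))
    (fun y => Complex.exp (z i * g y) - 1), integral_indicator_const _ (hA i)]
  simp

theorem integral_exp_sum_pointSum_jump :
    ∫ ω, Complex.exp (∑ i, z i * (pointSum (jump g (A i)) ω : ℝ)) ∂(poissonPointLaw unitCell) =
      Complex.exp (∑ i, volume.real (A i) * ∫ y, (Complex.exp (z i * g y) - 1)) := by
  have hw : Measurable fun p => ∑ i, z i * (jump g (A i) p : ℂ) :=
    Finset.measurable_fun_sum _ fun i _ =>
      (Complex.measurable_ofReal.comp (measurable_jump hg (hA i))).const_mul _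
  rw [← integral_exp_sum_mul_jump_sub_one hg h0 hint hA hAfin hz hdisj,
    ← integral_exp_pointSum hw (re_sum_mul_jump_nonpos h0 A hz)
      (integrable_min_one_norm_sum_mul_jump hg h0 hint hA hAfin z)]
  refine integral_congr_ae ?_
  filter_upwards [ae_all_iff.2 fun i => ae_summable_cellSum_jump hg h0 hint (hA i) (hAfin i)]
    with ω hω
  rw [pointSum_sum_mul_jump z hω]

end Integrable

end Jump

section IncrementTransform

variable {Ω : Type*} [MeasurableSpace Ω] {X : ℝ≥0 → Ω → ℝ} {P : Measure Ω} {K : ℝ → ℂ}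
  (hX : ∀ t, Measurable (X t))
  (hK : ∀ (n : ℕ) (t : Fin (n + 1) → ℝ≥0), Monotone t → ∀ ξ : Fin n → ℝ,
    ∫ ω, Complex.exp (∑ i, ξ i * Complex.I * (X (t i.succ) ω - X (t i.castSucc) ω : ℝ)) ∂P =
      Complex.exp (∑ i, ((t i.succ - t i.castSucc : ℝ≥0) : ℝ) * K (ξ i)))

section IncrementLaw

include hK

theorem integral_exp_increment {s t : ℝ≥0} (hst : s ≤ t) (ξ : ℝ) :
    ∫ ω, Complex.exp (ξ * Complex.I * (X t ω - X s ω : ℝ)) ∂P =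
      Complex.exp (((t - s : ℝ≥0) : ℝ) * K ξ) := by
  have hmono : Monotone ![s, t] := by
    rw [Fin.monotone_iff_le_succ]
    simpa using hst
  simpa using hK 1 ![s, t] hmono fun _ => ξ

include hX

theorem charFun_map_increment {s t : ℝ≥0} (hst : s ≤ t) (ξ : ℝ) :
    charFun (P.map fun ω => X t ω - X s ω) ξ = Complex.exp (((t - s : ℝ≥0) : ℝ) * K ξ) := by
  have hm : Measurable fun ω => X t ω - X s ω := (hX t).sub (hX s)
  rw [charFun_apply_real, integral_map hm.aemeasurable (by fun_prop),
    ← integral_exp_increment hK hst]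
  simp only [mul_right_comm]

end IncrementLaw

variable [IsProbabilityMeasure P]
include hX hK

theorem hasIndepIncrements_of_integral_exp : HasIndepIncrements X P := by
  intro n t ht
  have hm : ∀ i : Fin n, Measurable fun ω => X (t i.succ) ω - X (t i.castSucc) ω := fun i =>
    (hX _).sub (hX _)
  have hm_pi : Measurable fun ω => WithLp.toLp 2
    fun i : Fin n => X (t i.succ) ω - X (t i.castSucc) ω := by fun_prop
  rw [iIndepFun_iff_charFun_pi fun i => (hm i).aemeasurable]
  intro ξ
  simp only [charFun_map_increment hX hK (ht (Fin.castSucc_lt_succ (i := _)).le),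
    ← Complex.exp_sum]
  rw [charFun_apply, integral_map hm_pi.aemeasurable (by fun_prop), ← hK n t ht]
  refine integral_congr_ae (ae_of_all _ fun ω => ?_)
  simp only [PiLp.inner_apply, RCLike.inner_apply, conj_trivial]
  push_cast
  rw [Finset.sum_mul]
  exact congrArg Complex.exp (Finset.sum_congr rfl fun i _ => by ring)

theorem map_increment_eq_of_integral_exp (hzero : ∀ᵐ ω ∂P, X 0 ω = 0) {s t : ℝ≥0}
    (hst : s ≤ t) : P.map (fun ω => X t ω - X s ω) = P.map (X (t - s)) := by
  have hm : ∀ r, AEMeasurable (fun ω => X t ω - X r ω) P := fun r =>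
    ((hX t).sub (hX r)).aemeasurable
  have := Measure.isProbabilityMeasure_map (hm s)
  have := Measure.isProbabilityMeasure_map (μ := P) (hX (t - s)).aemeasurable
  have hstart : P.map (X (t - s)) = P.map fun ω => X (t - s) ω - X 0 ω :=
    Measure.map_congr (by filter_upwards [hzero] with ω hω; simp [hω])
  refine Measure.ext_of_charFun (funext fun ξ => ?_)
  rw [hstart, charFun_map_increment hX hK hst, charFun_map_increment hX hK zero_le, tsub_zero]

theorem isLevyProcess_of_integral_exp (hcadlag : ∀ ω, IsCadlagPath fun t => X t ω)
    (hzero : ∀ᵐ ω ∂P, X 0 ω = 0) : IsLevyProcess X P where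
  isProbabilityMeasure := inferInstance
  measurable := hX
  cadlag := hcadlag
  start_zero := hzero
  indep_increments := hasIndepIncrements_of_integral_exp hX hK
  stationary_increments _ _ := map_increment_eq_of_integral_exp hX hK hzero

end IncrementTransform

theorem continuousWithinAt_indicator_Ioc_zero (s : ℝ) (t : ℝ≥0) :
    ContinuousWithinAt (fun r : ℝ≥0 => (Ioc 0 (r : ℝ)).indicator (fun _ => (1 : ℝ)) s)
      (Ici t) t := by
  refine ContinuousWithinAt.congr_of_eventuallyEq
    (f := fun _ => (Ioc 0 (t : ℝ)).indicator (fun _ => (1 : ℝ)) s)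
    continuousWithinAt_const ?_ rfl
  rcases le_or_gt s t with hs | hs
  · filter_upwards [self_mem_nhdsWithin] with r hr
    have hsr : s ≤ r := hs.trans hr
    simp [indicator, hs, hsr]
  · have hlt : ∀ᶠ r : ℝ≥0 in 𝓝 t, (r : ℝ) < s :=
      NNReal.continuous_coe.continuousAt.eventually_lt_const hs
    filter_upwards [mem_nhdsWithin_of_mem_nhds hlt] with r hr
    simp [indicator, not_le.2 hs, not_le.2 hr]

theorem pairwise_disjoint_Ioc_castSucc_succ {n : ℕ} {t : Fin (n + 1) → ℝ≥0} (ht : Monotone t) :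
    Pairwise fun i j : Fin n =>
      Disjoint (Ioc (t i.castSucc : ℝ) (t i.succ)) (Ioc (t j.castSucc : ℝ) (t j.succ)) :=
  (pairwise_disjoint_on _).2 fun _ _ hij =>
    Set.Ioc_disjoint_Ioc_of_le (NNReal.coe_le_coe.2 (ht (Fin.succ_le_castSucc_iff.2 hij)))

section Subordinator

/-- The configurations in which the jumps in every bounded time interval are summable. -/
def regularConfigurations (g : ℝ → ℝ) : Set (PoissonConfiguration (ℤ × ℤ) (ℝ × ℝ)) :=
  {ω | ∀ n : ℕ, Summable fun c => cellSum (jump g (Ioc 0 (n : ℝ))) (ω c)}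

/-- The driftless subordinator with the jumps `g y` at time `s`, for `(s, y)` running through the
points of a Poisson process in the plane; it is frozen at `0` on irregular configurations. -/
noncomputable def poissonSubordinator (g : ℝ → ℝ) (t : ℝ≥0) :
    PoissonConfiguration (ℤ × ℤ) (ℝ × ℝ) → ℝ :=
  (regularConfigurations g).indicator (pointSum (jump g (Ioc 0 (t : ℝ))))

variable {g : ℝ → ℝ} {ω : PoissonConfiguration (ℤ × ℤ) (ℝ × ℝ)}

theorem poissonSubordinator_zero (g : ℝ → ℝ) (ω : PoissonConfiguration (ℤ × ℤ) (ℝ × ℝ)) :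
    poissonSubordinator g 0 ω = 0 := by
  by_cases hω : ω ∈ regularConfigurations g <;>
    simp [poissonSubordinator, hω, pointSum, cellSum, jump]

section Nonneg

variable (h0 : ∀ y, 0 ≤ g y)
include h0

theorem summable_cellSum_jump_of_mem_regularConfigurations (hω : ω ∈ regularConfigurations g)
    {A : Set ℝ} {t : ℝ≥0} (hA : A ⊆ Ioc 0 (t : ℝ)) :
    Summable fun c => cellSum (jump g A) (ω c) := by
  obtain ⟨n, hn⟩ := exists_nat_ge (t : ℝ)
  exact summable_cellSum_jump_of_subset h0 (hA.trans (Ioc_subset_Ioc_right hn)) (hω n)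

theorem mem_regularConfigurations_iff :
    ω ∈ regularConfigurations g ↔
      ∀ n : ℕ, ∑' c, ENNReal.ofReal (cellSum (jump g (Ioc 0 (n : ℝ))) (ω c)) ≠ ∞ := by
  refine forall_congr' fun n => ⟨Summable.tsum_ofReal_ne_top, fun h => ?_⟩
  refine (ENNReal.summable_toReal h).congr fun c => ?_
  rw [ENNReal.toReal_ofReal (cellSum_jump_nonneg h0 _ _)]

theorem measurableSet_regularConfigurations (hg : Measurable g) :
    MeasurableSet (regularConfigurations g) := by
  have hset : regularConfigurations g = ⋂ n : ℕ,
      {ω | ∑' c, ENNReal.ofReal (cellSum (jump g (Ioc 0 (n : ℝ))) (ω c)) ≠ ∞} := by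
    ext ω
    rw [mem_regularConfigurations_iff h0, mem_iInter]
    rfl
  rw [hset]
  refine MeasurableSet.iInter fun n => ?_
  have hm : Measurable fun ω : PoissonConfiguration (ℤ × ℤ) (ℝ × ℝ) =>
      ∑' c, ENNReal.ofReal (cellSum (jump g (Ioc 0 (n : ℝ))) (ω c)) :=
    Measurable.tsum fun c =>
      (measurable_cellSum_apply (measurable_jump hg measurableSet_Ioc) c).ennreal_ofReal
  exact hm (measurableSet_singleton ∞).compl

theorem measurable_poissonSubordinator (hg : Measurable g) (t : ℝ≥0) :
    Measurable (poissonSubordinator g t) :=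
  (measurable_pointSum (measurable_jump hg measurableSet_Ioc)).indicator
    (measurableSet_regularConfigurations h0 hg)

theorem monotone_poissonSubordinator (ω : PoissonConfiguration (ℤ × ℤ) (ℝ × ℝ)) :
    Monotone fun t => poissonSubordinator g t ω := by
  intro s t hst
  by_cases hω : ω ∈ regularConfigurations g
  · simp only [poissonSubordinator, indicator_of_mem hω]
    exact Summable.tsum_le_tsum (fun c => cellSum_jump_mono h0
      (Ioc_subset_Ioc_right (NNReal.coe_le_coe.2 hst)) _)
      (summable_cellSum_jump_of_mem_regularConfigurations h0 hω (t := s) subset_rfl)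
      (summable_cellSum_jump_of_mem_regularConfigurations h0 hω (t := t) subset_rfl)
  · simp [poissonSubordinator, indicator_of_notMem hω]

theorem continuousWithinAt_poissonSubordinator (ω : PoissonConfiguration (ℤ × ℤ) (ℝ × ℝ))
    (t : ℝ≥0) : ContinuousWithinAt (fun t => poissonSubordinator g t ω) (Ici t) t := by
  by_cases hω : ω ∈ regularConfigurations g
  · simp only [poissonSubordinator, indicator_of_mem hω]
    refine tendsto_tsum_of_dominated_convergence
      (summable_cellSum_jump_of_mem_regularConfigurations h0 hω (t := t + 1) subset_rfl)
      (fun c => ?_) ?_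
    · unfold cellSum jump
      exact tendsto_finsetSum _ fun k _ =>
        (continuousWithinAt_indicator_Ioc_zero _ t).tendsto.mul_const _
    · filter_upwards [mem_nhdsWithin_of_mem_nhds (Iio_mem_nhds (lt_add_one t))] with r hr c
      rw [Real.norm_of_nonneg (cellSum_jump_nonneg h0 _ _)]
      exact cellSum_jump_mono h0 (Ioc_subset_Ioc_right (NNReal.coe_le_coe.2 (le_of_lt hr))) _
  · simp only [poissonSubordinator, indicator_of_notMem hω]
    exact continuousWithinAt_const

theorem isCadlagPath_poissonSubordinator (ω : PoissonConfiguration (ℤ × ℤ) (ℝ × ℝ)) :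
    IsCadlagPath fun t => poissonSubordinator g t ω := fun t =>
  ⟨continuousWithinAt_poissonSubordinator h0 ω t, _,
    (monotone_poissonSubordinator h0 ω).tendsto_nhdsLT t⟩

theorem poissonSubordinator_sub (hω : ω ∈ regularConfigurations g) {s t : ℝ≥0} (hst : s ≤ t) :
    poissonSubordinator g t ω - poissonSubordinator g s ω =
      pointSum (jump g (Ioc (s : ℝ) t)) ω := by
  simp only [poissonSubordinator, indicator_of_mem hω, pointSum]
  rw [sub_eq_iff_eq_add', ← Summable.tsum_add
    (summable_cellSum_jump_of_mem_regularConfigurations h0 hω (t := s) subset_rfl)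
    (summable_cellSum_jump_of_mem_regularConfigurations h0 hω (t := t)
      (Ioc_subset_Ioc_left s.coe_nonneg))]
  refine tsum_congr fun c => ?_
  simp only [cellSum, ← Finset.sum_add_distrib]
  refine Finset.sum_congr rfl fun k _ => ?_
  rw [← jump_union (Set.Ioc_disjoint_Ioc_of_le le_rfl),
    Ioc_union_Ioc_eq_Ioc s.coe_nonneg (NNReal.coe_le_coe.2 hst)]

end Nonneg

variable (hg : Measurable g) (h0 : ∀ y, 0 ≤ g y) (hint : Integrable fun y => min 1 (g y))
include hg h0 hint

theorem ae_mem_regularConfigurations :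
    ∀ᵐ ω ∂(poissonPointLaw unitCell), ω ∈ regularConfigurations g :=
  ae_all_iff.2 fun _ => ae_summable_cellSum_jump hg h0 hint measurableSet_Ioc (by simp)

theorem integral_exp_sum_poissonSubordinator_sub {n : ℕ} {t : Fin (n + 1) → ℝ≥0}
    (ht : Monotone t) {z : Fin n → ℂ} (hz : ∀ i, (z i).re ≤ 0) :
    ∫ ω, Complex.exp (∑ i, z i * (poissonSubordinator g (t i.succ) ω -
        poissonSubordinator g (t i.castSucc) ω : ℝ)) ∂(poissonPointLaw unitCell) =
      Complex.exp (∑ i, ((t i.succ - t i.castSucc : ℝ≥0) : ℝ) *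
        ∫ y, (Complex.exp (z i * g y) - 1)) := by
  have hle : ∀ i : Fin n, t i.castSucc ≤ t i.succ := fun i => ht i.castSucc_lt_succ.le
  have hjoint := integral_exp_sum_pointSum_jump hg h0 hint
    (A := fun i : Fin n => Ioc (t i.castSucc : ℝ) (t i.succ)) (fun _ => measurableSet_Ioc)
    (fun _ => by simp) hz (pairwise_disjoint_Ioc_castSucc_succ ht)
  simp only [Real.volume_real_Ioc_of_le (NNReal.coe_le_coe.2 (hle _)),
    ← NNReal.coe_sub (hle _)] at hjoint
  rw [← hjoint]
  refine integral_congr_ae ?_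
  filter_upwards [ae_mem_regularConfigurations hg h0 hint] with ω hω
  simp only [poissonSubordinator_sub h0 hω (hle _)]

theorem integral_exp_poissonSubordinator (t : ℝ≥0) {z : ℂ} (hz : z.re ≤ 0) :
    ∫ ω, Complex.exp (z * poissonSubordinator g t ω) ∂(poissonPointLaw unitCell) =
      Complex.exp (t * ∫ y, (Complex.exp (z * g y) - 1)) := by
  have hmono : Monotone ![0, t] := by
    rw [Fin.monotone_iff_le_succ]
    simp
  simpa [poissonSubordinator_zero] using
    integral_exp_sum_poissonSubordinator_sub hg h0 hint hmono (z := fun _ => z) fun _ => hz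

theorem isLevyProcess_poissonSubordinator :
    IsLevyProcess (poissonSubordinator g) (poissonPointLaw unitCell) :=
  isLevyProcess_of_integral_exp (measurable_poissonSubordinator h0 hg)
    (K := fun ξ => ∫ y, (Complex.exp (ξ * Complex.I * g y) - 1))
    (fun _ _ ht ξ => integral_exp_sum_poissonSubordinator_sub hg h0 hint ht
      (z := fun i => ξ i * Complex.I) fun i => by simp)
    (isCadlagPath_poissonSubordinator h0) (ae_of_all _ (poissonSubordinator_zero g))

end Subordinator

section TailInverse

/-- The generalized inverse of a decreasing tail function `u` on `(0, ∞)`: it pushes Lebesgue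
measure forward to a measure giving `(x, ∞)` the mass `u x`. The value is `0` outside the range
of `u`. -/
noncomputable def tailInverse (u : ℝ → ℝ) (y : ℝ) : ℝ :=
  if 0 < y then sSup {x | 0 < x ∧ y < u x} else 0

variable {u : ℝ → ℝ}

theorem tailInverse_nonneg (u : ℝ → ℝ) (y : ℝ) : 0 ≤ tailInverse u y := by
  unfold tailInverse
  split_ifs
  · exact Real.sSup_nonneg fun x hx => hx.1.le
  · exact le_rfl

theorem bddAbove_setOf_lt_tail (hlim : Tendsto u atTop (𝓝 0)) {y : ℝ} (hy : 0 < y) :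
    BddAbove {x | 0 < x ∧ y < u x} := by
  obtain ⟨M, hM⟩ := eventually_atTop.1 (hlim.eventually_lt_const hy)
  exact ⟨M, fun x hx => le_of_not_gt fun hlt => (hM x hlt.le).not_gt hx.2⟩

variable (hanti : AntitoneOn u (Ioi 0)) (hcont : ContinuousOn u (Ioi 0))
  (hlim : Tendsto u atTop (𝓝 0))
include hanti hcont hlim

theorem lt_tailInverse_iff {x : ℝ} (hx : 0 < x) {y : ℝ} :
    x < tailInverse u y ↔ y ∈ Ioo 0 (u x) := by
  unfold tailInverse
  split_ifs with hy
  · constructor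
    · intro h
      have hne : {x | 0 < x ∧ y < u x}.Nonempty := by
        by_contra hempty
        rw [not_nonempty_iff_eq_empty.1 hempty, Real.sSup_empty] at h
        exact h.not_gt hx
      obtain ⟨z, ⟨hz, hyz⟩, hxz⟩ := exists_lt_of_lt_csSup hne h
      exact ⟨hy, hyz.trans_le (hanti hx hz hxz.le)⟩
    · rintro ⟨-, h⟩
      have hnear : ∀ᶠ z in 𝓝[>] x, y < u z :=
        ((hcont.continuousAt (Ioi_mem_nhds hx)).eventually_const_lt h).filter_mono
          nhdsWithin_le_nhds
      obtain ⟨z, hyz, hxz⟩ := (hnear.and self_mem_nhdsWithin).exists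
      exact (mem_Ioi.1 hxz).trans_le
        (le_csSup (bddAbove_setOf_lt_tail hlim hy) ⟨hx.trans hxz, hyz⟩)
  · exact ⟨fun h => absurd h hx.not_gt, fun h => absurd h.1 hy⟩

theorem measurable_tailInverse : Measurable (tailInverse u) := by
  have hpos : ∀ x, 0 < x → MeasurableSet (tailInverse u ⁻¹' Ioi x) := fun x hx => by
    have hset : tailInverse u ⁻¹' Ioi x = Ioo 0 (u x) :=
      Set.ext fun y => lt_tailInverse_iff hanti hcont hlim hx
    exact hset ▸ measurableSet_Ioo
  refine measurable_of_Ioi fun x => ?_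
  rcases lt_trichotomy x 0 with hx | rfl | hx
  · rw [eq_univ_of_forall fun y => show y ∈ tailInverse u ⁻¹' Ioi x from
      hx.trans_le (tailInverse_nonneg u y)]
    exact MeasurableSet.univ
  · have hUnion : Ioi (0 : ℝ) = ⋃ n : ℕ, Ioi (1 / ((n : ℝ) + 1)) := by
      ext y
      simp only [mem_Ioi, mem_iUnion]
      exact ⟨exists_nat_one_div_lt, fun ⟨n, hn⟩ => lt_trans (by positivity) hn⟩
    rw [hUnion, preimage_iUnion]
    exact MeasurableSet.iUnion fun n => hpos _ (by positivity)
  · exact hpos x hx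

theorem volume_setOf_lt_tailInverse {x : ℝ} (hx : 0 < x) :
    volume {y | x < tailInverse u y} = ENNReal.ofReal (u x) := by
  simp only [lt_tailInverse_iff hanti hcont hlim hx, Set.ofPred_mem_eq, Real.volume_Ioo, sub_zero]

end TailInverse

section LayerCake

theorem intervalIntegral_mul_exp_neg_mul (l t : ℝ) :
    ∫ x in (0 : ℝ)..t, l * Real.exp (-l * x) = 1 - Real.exp (-(l * t)) := by
  have hderiv : ∀ x : ℝ, HasDerivAt (fun x => -Real.exp (-l * x)) (l * Real.exp (-l * x)) x :=
    fun x => (((hasDerivAt_id x).const_mul (-l)).exp.neg).congr_deriv (by simp; ring)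
  rw [intervalIntegral.integral_eq_sub_of_hasDerivAt (fun x _ => hderiv x)
    (Continuous.intervalIntegrable (by fun_prop) _ _)]
  simp only [neg_mul, mul_zero, Real.exp_zero]
  ring

theorem min_one_le_two_mul_one_sub_exp_neg {x : ℝ} (hx : 0 ≤ x) :
    min 1 x ≤ 2 * (1 - Real.exp (-x)) := by
  have hexp : Real.exp (-x) ≤ (1 + x)⁻¹ := by
    rw [Real.exp_neg]
    exact inv_anti₀ (by positivity) (by linarith [Real.add_one_le_exp x])
  have hmin : min 1 x ≤ 2 * (1 - (1 + x)⁻¹) := by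
    rw [show 2 * (1 - (1 + x)⁻¹) = 2 * x / (1 + x) by field_simp; ring, le_div_iff₀ (by positivity)]
    rcases min_cases 1 x with ⟨h, _⟩ | ⟨h, _⟩ <;> rw [h] <;> nlinarith
  linarith

theorem one_sub_exp_neg_mul_nonneg {l x : ℝ} (hl : 0 ≤ l) (hx : 0 ≤ x) :
    0 ≤ 1 - Real.exp (-(l * x)) :=
  sub_nonneg.2 (Real.exp_le_one_iff.2 (neg_nonpos.2 (mul_nonneg hl hx)))

variable {α : Type*} [MeasurableSpace α] {m : Measure α} {f : α → ℝ} {u : ℝ → ℝ} {l : ℝ}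
  (hf : Measurable f) (hf0 : ∀ y, 0 ≤ f y) (hu : ∀ x, 0 ≤ u x)
  (htail : ∀ x, 0 < x → m {y | x < f y} = ENNReal.ofReal (u x)) (hl : 0 ≤ l)
  (hint : IntegrableOn (fun x => Real.exp (-l * x) * u x) (Ioi 0))
include hf hf0 hu htail hl hint

theorem lintegral_one_sub_exp_of_tail :
    ∫⁻ y, ENNReal.ofReal (1 - Real.exp (-(l * f y))) ∂m =
      ENNReal.ofReal (l * ∫ x in Ioi 0, Real.exp (-l * x) * u x) := by
  have hlayer := lintegral_comp_eq_lintegral_meas_lt_mul m (f := f)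
    (g := fun x => l * Real.exp (-l * x)) (ae_of_all _ hf0) hf.aemeasurable
    (fun t _ => Continuous.intervalIntegrable (by fun_prop) _ _)
    (ae_of_all _ fun t => by positivity)
  simp only [intervalIntegral_mul_exp_neg_mul] at hlayer
  rw [hlayer, ← integral_const_mul, ofReal_integral_eq_lintegral_ofReal (hint.const_mul l)
    (ae_of_all _ fun x => mul_nonneg hl (mul_nonneg (Real.exp_pos _).le (hu x)))]
  refine setLIntegral_congr_fun measurableSet_Ioi fun x hx => ?_
  rw [htail x hx, ← ENNReal.ofReal_mul (hu x)]
  congr 1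
  ring

theorem integrable_one_sub_exp_of_tail :
    Integrable (fun y => 1 - Real.exp (-(l * f y))) m := by
  refine ⟨Measurable.aestronglyMeasurable (by fun_prop), ?_⟩
  rw [hasFiniteIntegral_iff_ofReal (ae_of_all _ fun y => one_sub_exp_neg_mul_nonneg hl (hf0 y)),
    lintegral_one_sub_exp_of_tail hf hf0 hu htail hl hint]
  exact ENNReal.ofReal_lt_top

theorem integral_one_sub_exp_of_tail :
    ∫ y, (1 - Real.exp (-(l * f y))) ∂m = l * ∫ x in Ioi 0, Real.exp (-l * x) * u x := by
  have hnonneg : 0 ≤ l * ∫ x in Ioi 0, Real.exp (-l * x) * u x :=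
    mul_nonneg hl (integral_nonneg fun x => mul_nonneg (Real.exp_pos _).le (hu x))
  rw [integral_eq_lintegral_of_nonneg_ae
    (ae_of_all _ fun y => one_sub_exp_neg_mul_nonneg hl (hf0 y))
    (Measurable.aestronglyMeasurable (by fun_prop)),
    lintegral_one_sub_exp_of_tail hf hf0 hu htail hl hint, ENNReal.toReal_ofReal hnonneg]

omit hl hint in
theorem integrable_min_one_of_tail
    (hint : IntegrableOn (fun x => Real.exp (-1 * x) * u x) (Ioi 0)) :
    Integrable (fun y => min 1 (f y)) m := by
  refine ((integrable_one_sub_exp_of_tail hf hf0 hu htail zero_le_one hint).const_mul 2).mono'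
    (by fun_prop) (ae_of_all _ fun y => ?_)
  rw [Real.norm_of_nonneg (le_min zero_le_one (hf0 y)), one_mul]
  exact min_one_le_two_mul_one_sub_exp_neg (hf0 y)

end LayerCake

section DriftMinusSubordinator

variable {g : ℝ → ℝ}

/-- The Lévy measure of the negative of a subordinator whose jumps are `g y`, with `y` ranging over
the line with intensity Lebesgue measure. -/
noncomputable def negJumpMeasure (g : ℝ → ℝ) : Measure ℝ :=
  (volume.map fun y => -g y).restrict (Iio 0)

/-- Unit drift minus the Poisson subordinator with jumps given by `g`. -/
noncomputable def driftMinusSubordinator (g : ℝ → ℝ) (t : ℝ≥0)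
    (ω : PoissonConfiguration (ℤ × ℤ) (ℝ × ℝ)) : ℝ :=
  t - poissonSubordinator g t ω

theorem negJumpMeasure_Ioi (g : ℝ → ℝ) : negJumpMeasure g (Ioi 0) = 0 := by
  rw [negJumpMeasure, Measure.restrict_apply measurableSet_Ioi,
    disjoint_iff_inter_eq_empty.1 (Iio_disjoint_Ioi_same (a := (0 : ℝ))).symm, measure_empty]

theorem negJumpMeasure_singleton_zero (g : ℝ → ℝ) : negJumpMeasure g {0} = 0 := by
  simp [negJumpMeasure, Measure.restrict_apply]

theorem negJumpMeasure_Iio_neg (hg : Measurable g) {x : ℝ} (hx : 0 < x) :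
    negJumpMeasure g (Iio (-x)) = volume {y | x < g y} := by
  have hneg : Measurable fun y => -g y := hg.neg
  rw [negJumpMeasure, Measure.restrict_apply measurableSet_Iio,
    inter_eq_left.2 (Iio_subset_Iio (by linarith)), Measure.map_apply hneg measurableSet_Iio]
  simp [preimage]

variable (hg : Measurable g) (h0 : ∀ y, 0 ≤ g y)
include hg h0

theorem integral_negJumpMeasure {F : ℝ → ℂ} (hF : Measurable F) (hF0 : F 0 = 0) :
    ∫ x, F x ∂(negJumpMeasure g) = ∫ y, F (-g y) := by
  have hneg : Measurable fun y => -g y := hg.neg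
  have hle : ∀ᵐ x ∂(volume.map fun y => -g y), x ≤ 0 :=
    (ae_map_iff hneg.aemeasurable measurableSet_Iic).2
      (ae_of_all _ fun y => neg_nonpos.2 (h0 y))
  rw [negJumpMeasure, setIntegral_eq_integral_of_ae_compl_eq_zero,
    integral_map hneg.aemeasurable hF.aestronglyMeasurable]
  filter_upwards [hle] with x hx hx0
  rw [le_antisymm hx (not_lt.1 hx0), hF0]

variable (hint : Integrable fun y => min 1 (g y))
include hint

theorem lintegral_min_one_sq_negJumpMeasure_lt_top :
    ∫⁻ x, ENNReal.ofReal (min 1 (x ^ 2)) ∂(negJumpMeasure g) < ∞ := by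
  have hneg : Measurable fun y => -g y := hg.neg
  refine (setLIntegral_le_lintegral _ _).trans_lt ?_
  rw [lintegral_map (by fun_prop) hneg]
  refine (lintegral_mono fun y => ENNReal.ofReal_le_ofReal ?_).trans_lt
    ((hasFiniteIntegral_iff_ofReal
      (ae_of_all _ fun y => le_min zero_le_one (h0 y))).1 hint.2)
  have hy := h0 y
  rw [neg_sq]
  rcases min_cases 1 (g y) with ⟨h, _⟩ | ⟨h, _⟩ <;> rw [h]
  · exact min_le_left _ _
  · exact (min_le_right _ _).trans (by nlinarith)

omit h0 in
theorem integrableOn_setOf_lt_one : IntegrableOn g {y | g y < 1} := by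
  refine hint.integrableOn.congr_fun (fun y hy => ?_) (measurableSet_lt hg measurable_const)
  exact min_eq_right (le_of_lt hy)

theorem integral_levyKhintchineIntegrand_neg (θ : ℝ) :
    ∫ y, levyKhintchineIntegrand θ (-g y) =
      -(∫ y, (Complex.exp (-(Complex.I * θ) * g y) - 1)) -
        Complex.I * θ * (∫ y in {y | g y < 1}, g y : ℝ) := by
  have hsmall : MeasurableSet {y | g y < 1} := measurableSet_lt hg measurable_const
  have hpoint : ∀ y, levyKhintchineIntegrand θ (-g y) =
      -(Complex.exp (-(Complex.I * θ) * g y) - 1) -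
        Complex.I * θ * ({y | g y < 1}.indicator g y : ℝ) := fun y => by
    rw [levyKhintchineIntegrand, abs_neg, abs_of_nonneg (h0 y)]
    by_cases hy : g y < 1
    · simp only [Complex.ofReal_neg, mul_neg, hy, ↓reduceIte, neg_mul, neg_sub, mem_ofPred_eq,
        indicator_of_mem]
      ring
    · simp [hy]
  have hexp : Integrable fun y => -(Complex.exp (-(Complex.I * θ) * g y) - 1) :=
    (integrable_exp_mul_sub_one hg h0 hint (by simp)).neg
  have hsmallint : Integrable fun y => Complex.I * θ * ({y | g y < 1}.indicator g y : ℝ) :=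
    ((integrable_indicator_iff hsmall).2 (integrableOn_setOf_lt_one hg hint)).ofReal.const_mul _
  simp only [hpoint]
  rw [integral_sub hexp hsmallint, integral_neg, integral_const_mul, integral_complex_ofReal,
    integral_indicator hsmall]

theorem isLevyProcess_driftMinusSubordinator :
    IsLevyProcess (driftMinusSubordinator g) (poissonPointLaw unitCell) := by
  have h := (isLevyProcess_poissonSubordinator hg h0 hint).mul_add_mul (-1) 1
  convert h using 3
  rw [driftMinusSubordinator]
  ring

theorem integral_exp_mul_driftMinusSubordinator (t : ℝ≥0) {z : ℂ} (hz : 0 ≤ z.re) :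
    ∫ ω, Complex.exp (z * driftMinusSubordinator g t ω) ∂(poissonPointLaw unitCell) =
      Complex.exp (t * (z + ∫ y, (Complex.exp (-z * g y) - 1))) := by
  have hexp : ∀ ω, Complex.exp (z * driftMinusSubordinator g t ω) =
      Complex.exp (-z * poissonSubordinator g t ω) * Complex.exp (t * z) := fun ω => by
    rw [← Complex.exp_add, driftMinusSubordinator]
    push_cast
    ring_nf
  simp only [hexp]
  rw [integral_mul_const, integral_exp_poissonSubordinator hg h0 hint t (by simpa using hz),
    ← Complex.exp_add]
  ring_nf

theorem hasLaplaceExponent_driftMinusSubordinator :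
    HasLaplaceExponent (driftMinusSubordinator g) (poissonPointLaw unitCell)
      fun l => l - ∫ y, (1 - Real.exp (-(l * g y))) := by
  intro t l hl
  constructor
  · have hm := (isLevyProcess_driftMinusSubordinator hg h0 hint).measurable t
    refine Integrable.of_bound (C := Real.exp (l * t)) (by fun_prop) (ae_of_all _ fun ω => ?_)
    have hnonneg : 0 ≤ poissonSubordinator g t ω := by
      rw [← poissonSubordinator_zero g ω]
      exact monotone_poissonSubordinator h0 ω zero_le
    rw [Real.norm_of_nonneg (Real.exp_pos _).le, driftMinusSubordinator]
    gcongr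
    linarith
  · have h := integral_exp_mul_driftMinusSubordinator hg h0 hint t (z := (l : ℂ))
      (by simpa using hl)
    have hreal : ∫ y, (Complex.exp (-(l : ℂ) * g y) - 1) =
        ((-∫ y, (1 - Real.exp (-(l * g y))) : ℝ) : ℂ) := by
      rw [← integral_neg, ← integral_complex_ofReal]
      refine integral_congr_ae (ae_of_all _ fun y => ?_)
      push_cast
      ring_nf
    rw [hreal] at h
    simp only [← Complex.ofReal_mul, ← Complex.ofReal_exp, integral_complex_ofReal] at h
    norm_cast at h
    rw [h]
    ring_nf

theorem hasLevyTriplet_driftMinusSubordinator :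
    HasLevyTriplet (driftMinusSubordinator g) (poissonPointLaw unitCell)
      (-1 + ∫ y in {y | g y < 1}, g y) 0 (negJumpMeasure g) where
  no_mass_zero := negJumpMeasure_singleton_zero g
  lintegral_lt_top := lintegral_min_one_sq_negJumpMeasure_lt_top hg h0 hint
  exponent t θ := by
    have hintegral := (integral_negJumpMeasure hg h0 (measurable_levyKhintchineIntegrand θ)
      (by simp [levyKhintchineIntegrand])).trans
      (integral_levyKhintchineIntegrand_neg hg h0 hint θ)
    simp only [levyKhintchineIntegrand] at hintegral
    rw [integral_exp_mul_driftMinusSubordinator hg h0 hint t (by simp), levyKhintchineExponent,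
      hintegral]
    push_cast
    ring_nf

end DriftMinusSubordinator

theorem exists_levyProcess_of_tail {u : ℝ → ℝ} (hu : ∀ x, 0 ≤ u x) (hanti : AntitoneOn u (Ioi 0))
    (hcont : ContinuousOn u (Ioi 0)) (hlim : Tendsto u atTop (𝓝 0))
    (hint : ∀ l, 0 < l → IntegrableOn (fun x => Real.exp (-l * x) * u x) (Ioi 0)) :
    ∃ (Ω : Type) (_ : MeasurableSpace Ω) (P : Measure Ω) (Y : ℝ≥0 → Ω → ℝ),
      IsLevyProcess Y P ∧
      HasLaplaceExponent Y P (fun l => l - l * ∫ x in Ioi 0, Real.exp (-l * x) * u x) ∧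
      ∃ (μ : ℝ) (ν : Measure ℝ), HasLevyTriplet Y P μ 0 ν ∧ ν (Ioi 0) = 0 ∧
        ∀ x, 0 < x → ν (Iio (-x)) = ENNReal.ofReal (u x) := by
  have hg := measurable_tailInverse hanti hcont hlim
  have htail : ∀ x, 0 < x → volume {y | x < tailInverse u y} = ENNReal.ofReal (u x) := fun x hx =>
    volume_setOf_lt_tailInverse hanti hcont hlim hx
  have hmin := integrable_min_one_of_tail hg (tailInverse_nonneg u) hu htail (hint 1 one_pos)
  refine ⟨_, _, poissonPointLaw unitCell, driftMinusSubordinator (tailInverse u),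
    isLevyProcess_driftMinusSubordinator hg (tailInverse_nonneg u) hmin, ?_,
    _, _, hasLevyTriplet_driftMinusSubordinator hg (tailInverse_nonneg u) hmin,
    negJumpMeasure_Ioi _, fun x hx => (negJumpMeasure_Iio_neg hg hx).trans (htail x hx)⟩
  refine (hasLaplaceExponent_driftMinusSubordinator hg (tailInverse_nonneg u) hmin).congr
    fun l hl => ?_
  rcases (mem_Ici.1 hl).eq_or_lt with rfl | hl
  · simp
  · simp only [integral_one_sub_exp_of_tail hg (tailInverse_nonneg u) hu htail hl.le (hint l hl)]

section Primitive

/-- The primitive `x ↦ ∫₀ˣ u` of a function on `(0, ∞)`, extended by `0` to `(-∞, 0]`; it turns the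
tail function of the jumps into a scale function. -/
noncomputable def primitiveIoi (u : ℝ → ℝ) (x : ℝ) : ℝ :=
  ∫ s in (0 : ℝ)..x, (Ioi 0).indicator u s

variable {u : ℝ → ℝ} {θ : ℝ}

theorem primitiveIoi_of_neg (u : ℝ → ℝ) {x : ℝ} (hx : x < 0) : primitiveIoi u x = 0 := by
  refine intervalIntegral.integral_zero_ae (ae_of_all _ fun s hs => ?_)
  rw [uIoc_of_ge hx.le] at hs
  exact indicator_of_notMem (not_lt.2 hs.2) _

theorem primitiveIoi_nonneg (hu : ∀ x, 0 ≤ u x) (x : ℝ) : 0 ≤ primitiveIoi u x := by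
  rcases lt_or_ge x 0 with hx | hx
  · exact (primitiveIoi_of_neg u hx).ge
  · exact intervalIntegral.integral_nonneg hx fun s _ => indicator_nonneg (fun y _ => hu y) s

variable (hint : IntegrableOn (fun x => Real.exp (-θ * x) * u x) (Ioi 0))
include hint

theorem intervalIntegrable_indicator_Ioi (a b : ℝ) :
    IntervalIntegrable ((Ioi 0).indicator u) volume a b := by
  have hmul := ((integrable_indicator_iff measurableSet_Ioi).2 hint).intervalIntegrable
    (a := a) (b := b) |>.continuousOn_mul (g := fun x => Real.exp (θ * x)) (by fun_prop)
  refine hmul.congr fun x _ => ?_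
  by_cases hx : x ∈ Ioi (0 : ℝ)
  · simp only [indicator_of_mem hx, ← mul_assoc, ← Real.exp_add, neg_mul, add_neg_cancel,
      Real.exp_zero, one_mul]
  · simp only [indicator_of_notMem hx, mul_zero]

theorem continuous_primitiveIoi : Continuous (primitiveIoi u) :=
  intervalIntegral.continuous_primitive (intervalIntegrable_indicator_Ioi hint) 0

theorem hasDerivAt_primitiveIoi (hcont : ContinuousOn u (Ioi 0)) {x : ℝ} (hx : 0 < x) :
    HasDerivAt (primitiveIoi u) (u x) x := by
  have heq : EqOn ((Ioi 0).indicator u) u (Ioi 0) := fun y hy => indicator_of_mem hy _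
  have hcont' : ContinuousOn ((Ioi 0).indicator u) (Ioi 0) := hcont.congr heq
  have h := intervalIntegral.integral_hasDerivAt_right (intervalIntegrable_indicator_Ioi hint 0 x)
    (hcont'.stronglyMeasurableAtFilter isOpen_Ioi x hx) (hcont'.continuousAt (Ioi_mem_nhds hx))
  rwa [heq hx] at h

variable (hu : ∀ x, 0 ≤ u x) (hθ : 0 < θ)
include hu hθ

theorem lintegral_exp_neg_mul_mul_primitiveIoi :
    ∫⁻ x in Ioi 0, ENNReal.ofReal (Real.exp (-θ * x) * primitiveIoi u x) =
      ENNReal.ofReal ((∫ x in Ioi 0, Real.exp (-θ * x) * u x) / θ) := by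
  have hmeas := (continuous_primitiveIoi hint).measurable
  have hlayer := lintegral_comp_eq_lintegral_meas_lt_mul
    ((volume.restrict (Ioi 0)).withDensity fun x => ENNReal.ofReal (Real.exp (-θ * x)))
    (f := fun x => x) (g := (Ioi 0).indicator u)
    ((withDensity_absolutelyContinuous _ _).ae_le
      ((ae_restrict_mem measurableSet_Ioi).mono fun x hx => (mem_Ioi.1 hx).le))
    measurable_id.aemeasurable (fun t _ => intervalIntegrable_indicator_Ioi hint 0 t)
    (ae_of_all _ (indicator_nonneg fun y _ => hu y))
  have hprimitive : ∀ x, ∫ s in (0 : ℝ)..x, (Ioi 0).indicator u s = primitiveIoi u x := fun _ => rfl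
  simp only [hprimitive] at hlayer
  rw [lintegral_withDensity_eq_lintegral_mul _ (by fun_prop) (by fun_prop)] at hlayer
  simp only [Pi.mul_apply, ← ENNReal.ofReal_mul (Real.exp_pos _).le] at hlayer
  rw [hlayer, ← integral_div, ofReal_integral_eq_lintegral_ofReal (hint.div_const θ)
    (ae_of_all _ fun x => div_nonneg (mul_nonneg (Real.exp_pos _).le (hu x)) hθ.le)]
  refine setLIntegral_congr_fun measurableSet_Ioi fun t ht => ?_
  have hmass : ∫⁻ x in Ioi t, ENNReal.ofReal (Real.exp (-θ * x)) =
      ENNReal.ofReal (Real.exp (-θ * t) / θ) := by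
    rw [← ofReal_integral_eq_lintegral_ofReal (integrableOn_exp_mul_Ioi (neg_lt_zero.2 hθ) t)
      (ae_of_all _ fun x => (Real.exp_pos _).le), integral_exp_mul_Ioi (neg_lt_zero.2 hθ),
      neg_div_neg_eq]
  have htail : {a : ℝ | t < a} = Ioi t := rfl
  rw [htail, withDensity_apply _ measurableSet_Ioi, Measure.restrict_restrict measurableSet_Ioi,
    inter_eq_left.2 (Ioi_subset_Ioi (mem_Ioi.1 ht).le), hmass, indicator_of_mem ht,
    ← ENNReal.ofReal_mul (by positivity), div_mul_eq_mul_div]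

theorem integrableOn_exp_neg_mul_mul_primitiveIoi :
    IntegrableOn (fun x => Real.exp (-θ * x) * primitiveIoi u x) (Ioi 0) := by
  have hmeas := (continuous_primitiveIoi hint).measurable
  refine ⟨Measurable.aestronglyMeasurable (by fun_prop), ?_⟩
  rw [hasFiniteIntegral_iff_ofReal (ae_of_all _ fun x =>
    mul_nonneg (Real.exp_pos _).le (primitiveIoi_nonneg hu x)),
    lintegral_exp_neg_mul_mul_primitiveIoi hint hu hθ]
  exact ENNReal.ofReal_lt_top

theorem integral_exp_neg_mul_mul_primitiveIoi :
    ∫ x in Ioi 0, Real.exp (-θ * x) * primitiveIoi u x =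
      (∫ x in Ioi 0, Real.exp (-θ * x) * u x) / θ := by
  have hmeas := (continuous_primitiveIoi hint).measurable
  rw [integral_eq_lintegral_of_nonneg_ae (ae_of_all _ fun x =>
    mul_nonneg (Real.exp_pos _).le (primitiveIoi_nonneg hu x))
    (Measurable.aestronglyMeasurable (by fun_prop)),
    lintegral_exp_neg_mul_mul_primitiveIoi hint hu hθ, ENNReal.toReal_ofReal]
  exact div_nonneg (integral_nonneg fun x => mul_nonneg (Real.exp_pos _).le (hu x)) hθ.le

end Primitive

section ShiftedExponent

variable {ψ W : ℝ → ℝ}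

theorem shiftedExponent_zero (ψ : ℝ → ℝ) : shiftedExponent ψ 0 = 0 := by simp [shiftedExponent]

theorem largestRoot_eq_zero (h0 : ψ 0 = 0) (hpos : ∀ θ, 0 < θ → 0 < ψ θ) : largestRoot ψ = 0 := by
  have hroots : {l : ℝ | 0 ≤ l ∧ ψ l = 0} = {0} := Set.ext fun l =>
    ⟨fun h => le_antisymm (not_lt.1 fun hl => (hpos l hl).ne' h.2) h.1, by
      rintro rfl
      exact ⟨le_rfl, h0⟩⟩
  rw [largestRoot, hroots, csSup_singleton]

theorem isScaleFunction_primitiveIoi {u : ℝ → ℝ} (h0 : ψ 0 = 0) (hpos : ∀ θ, 0 < θ → 0 < ψ θ)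
    (hu : ∀ x, 0 ≤ u x)
    (hlap : ∀ θ, 0 < θ → IntegrableOn (fun x => Real.exp (-θ * x) * u x) (Ioi 0) ∧
      ∫ x in Ioi 0, Real.exp (-θ * x) * u x = θ / ψ θ) : IsScaleFunction ψ (primitiveIoi u) where
  nonneg := primitiveIoi_nonneg hu
  eq_zero_of_neg _ := primitiveIoi_of_neg u
  right_continuous _ _ := (continuous_primitiveIoi (hlap 1 one_pos).1).continuousWithinAt
  laplace θ hθ := by
    rw [largestRoot_eq_zero h0 hpos] at hθ
    obtain ⟨hint, hval⟩ := hlap θ hθ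
    refine ⟨integrableOn_exp_neg_mul_mul_primitiveIoi hint hu hθ, ?_⟩
    rw [integral_exp_neg_mul_mul_primitiveIoi hint hu hθ, hval, div_right_comm, div_self hθ.ne']

theorem IsLevyProcess.exists_mul_lt_exponent {Ω : Type*} [MeasurableSpace Ω] {P : Measure Ω}
    {X : ℝ≥0 → Ω → ℝ} (hX : IsLevyProcess X P) (hψ : HasLaplaceExponent X P ψ)
    (hvar : ¬ HasBoundedVariationPaths X P) (c : ℝ) : ∃ θ, 0 < θ ∧ c * θ < ψ θ := by
  contrapose! hvar
  exact hX.hasBoundedVariationPaths hψ hvar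

theorem IsCompleteScaleFunction.exists_laplace_density (hW : IsCompleteScaleFunction ψ W)
    (h0 : ψ 0 = 0) (hpos : ∀ θ, 0 < θ → 0 < ψ θ) (hunb : ∀ c, ∃ θ, 0 < θ ∧ c * θ < ψ θ) :
    ∃ u : ℝ → ℝ, (∀ x, 0 ≤ u x) ∧ AntitoneOn u (Ioi 0) ∧ ContinuousOn u (Ioi 0) ∧
      Tendsto u atTop (𝓝 0) ∧ ∀ θ, 0 < θ →
        IntegrableOn (fun x => Real.exp (-θ * x) * u x) (Ioi 0) ∧
        ∫ x in Ioi 0, Real.exp (-θ * x) * u x = θ / (ψ θ + θ) := by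
  obtain ⟨-, φ, hφ, hfactor⟩ := hW
  have hstieltjes : IsStieltjes fun θ => θ / (ψ θ + θ) :=
    (hφ.isStieltjes_inv_add one_pos).congr fun θ hθ => by
      rw [hfactor θ hθ, largestRoot_eq_zero h0 hpos, sub_zero, ← mul_add_one,
        div_mul_cancel_left₀ hθ.ne', add_comm]
  refine hstieltjes.exists_laplace_density (B := 1) (fun ε hε => ?_) fun θ hθ => ?_
  · obtain ⟨θ, hθ, hlarge⟩ := hunb ε⁻¹
    refine ⟨θ, hθ, (div_lt_iff₀ (add_pos (hpos θ hθ) hθ)).2 ?_⟩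
    rw [inv_mul_lt_iff₀ hε] at hlarge
    nlinarith
  · exact div_le_one_of_le₀ (by linarith [hpos θ hθ]) (add_pos (hpos θ hθ) hθ).le

variable (hpos : ∀ θ, 0 < θ → 0 < ψ θ)
include hpos

theorem shiftedExponent_pos {θ : ℝ} (hθ : 0 < θ) : 0 < shiftedExponent ψ θ :=
  div_pos (mul_pos hθ (hpos θ hθ)) (add_pos hθ (hpos θ hθ))

theorem shiftedExponent_lt_id {θ : ℝ} (hθ : 0 < θ) : shiftedExponent ψ θ < θ := by
  rw [shiftedExponent, div_lt_iff₀ (add_pos hθ (hpos θ hθ))]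
  nlinarith

theorem shiftedExponent_lt {θ : ℝ} (hθ : 0 < θ) : shiftedExponent ψ θ < ψ θ := by
  have := hpos θ hθ
  rw [shiftedExponent, div_lt_iff₀ (add_pos hθ this)]
  nlinarith

theorem hasDerivWithinAt_shiftedExponent (h0 : ψ 0 = 0) (hd : HasDerivWithinAt ψ 0 (Ioi 0) 0) :
    HasDerivWithinAt (shiftedExponent ψ) 0 (Ioi 0) 0 := by
  rw [hasDerivWithinAt_iff_isLittleO] at hd ⊢
  simp only [h0, shiftedExponent_zero, smul_zero, sub_zero] at hd ⊢
  refine (Asymptotics.IsBigO.of_bound 1 ?_).trans_isLittleO hd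
  filter_upwards [self_mem_nhdsWithin] with θ hθ
  rw [one_mul, Real.norm_of_nonneg (shiftedExponent_pos hpos hθ).le,
    Real.norm_of_nonneg (hpos θ hθ).le]
  exact (shiftedExponent_lt hpos hθ).le

theorem isScaleFunction_shiftedScale (hW : IsScaleFunction ψ W) (h0 : ψ 0 = 0) :
    IsScaleFunction (shiftedExponent ψ) (shiftedScale W) where
  nonneg := indicator_nonneg fun x _ => add_nonneg zero_le_one (hW.nonneg x)
  eq_zero_of_neg _ hx := indicator_of_notMem (not_le.2 hx) _
  right_continuous x hx := (continuousWithinAt_const.add (hW.right_continuous x hx)).congr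
    (fun _ hy => indicator_of_mem (mem_Ici.2 (hx.trans hy)) _) (indicator_of_mem hx _)
  laplace θ hθ := by
    rw [largestRoot_eq_zero (shiftedExponent_zero ψ) fun θ => shiftedExponent_pos hpos] at hθ
    obtain ⟨hint, hval⟩ := hW.laplace θ (by rwa [largestRoot_eq_zero h0 hpos])
    have hsplit : EqOn (fun x => Real.exp (-θ * x) * shiftedScale W x)
        (fun x => Real.exp (-θ * x) + Real.exp (-θ * x) * W x) (Ioi 0) := fun x hx => by
      simp only [shiftedScale, indicator_of_mem (Ioi_subset_Ici_self hx), mul_add, mul_one]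
    have hexp := integrableOn_exp_neg_mul_Ioi hθ
    refine ⟨(hexp.add hint).congr_fun hsplit.symm measurableSet_Ioi, ?_⟩
    rw [setIntegral_congr_fun measurableSet_Ioi hsplit, integral_add hexp hint, hval,
      integral_exp_neg_mul_Ioi hθ, shiftedExponent]
    have := hpos θ hθ
    field_simp
    ring

theorem exists_isSpectrallyNegativeLevy_shiftedExponent {u : ℝ → ℝ} (h0 : ψ 0 = 0)
    (hd : HasDerivWithinAt ψ 0 (Ioi 0) 0) (hu : ∀ x, 0 ≤ u x) (hanti : AntitoneOn u (Ioi 0))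
    (hcont : ContinuousOn u (Ioi 0)) (hlim : Tendsto u atTop (𝓝 0))
    (hlap : ∀ θ, 0 < θ → IntegrableOn (fun x => Real.exp (-θ * x) * u x) (Ioi 0) ∧
      ∫ x in Ioi 0, Real.exp (-θ * x) * u x = θ / (ψ θ + θ)) :
    ∃ (Ω : Type) (_ : MeasurableSpace Ω) (P : Measure Ω) (Y : ℝ≥0 → Ω → ℝ),
      IsSpectrallyNegativeLevy Y P ∧ HasLaplaceExponent Y P (shiftedExponent ψ) ∧
      ∃ (μ : ℝ) (ν : Measure ℝ), HasLevyTriplet Y P μ 0 ν ∧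
        ∀ x, 0 < x → ν (Iio (-x)) = ENNReal.ofReal (u x) := by
  obtain ⟨Ω, _, P, Y, hY, hexponent, μ, ν, htriplet, hν, htail⟩ :=
    exists_levyProcess_of_tail hu hanti hcont hlim fun θ hθ => (hlap θ hθ).1
  have hshifted : HasLaplaceExponent Y P (shiftedExponent ψ) :=
    hexponent.congr fun θ hθ => by
      rcases (mem_Ici.1 hθ).eq_or_lt with rfl | hθ
      · simp [shiftedExponent]
      · have := hpos θ hθ
        simp only [(hlap θ hθ).2, shiftedExponent]
        field_simp
        ring
  have hone := shiftedExponent_pos hpos one_pos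
  exact ⟨Ω, _, P, Y, ⟨hY, ⟨μ, 0, ν, htriplet, hν⟩,
    hY.not_monotone_of_hasDerivWithinAt hshifted (hasDerivWithinAt_shiftedExponent hpos h0 hd) hone,
    hY.not_antitone_of_exponent_pos hshifted hone⟩, hshifted, μ, ν, htriplet, htail⟩

end ShiftedExponent

theorem mainTheorem10 {Ω : Type*} [MeasurableSpace Ω] (P : Measure Ω) (X : ℝ≥0 → Ω → ℝ)
    (ψ W : ℝ → ℝ)
    (hX : IsSpectrallyNegativeLevy X P)
    (hψ : HasLaplaceExponent X P ψ)
    (hvar : ¬ HasBoundedVariationPaths X P)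
    (hψ' : HasDerivWithinAt ψ 0 (Ioi 0) 0)
    (hW : IsCompleteScaleFunction ψ W) :
    -- a spectrally negative Lévy process with exponent `ψˢ` exists
    (∃ (Ω' : Type) (_ : MeasurableSpace Ω') (P' : Measure Ω') (Y : ℝ≥0 → Ω' → ℝ),
      IsSpectrallyNegativeLevy Y P' ∧ HasLaplaceExponent Y P' (shiftedExponent ψ)) ∧
    -- `1 + W` is its scale function
    IsScaleFunction (shiftedExponent ψ) (shiftedScale W) ∧
    -- `X_t + t` is spectrally negative with exponent `ψ(θ) + θ`, and has a scale function
    IsSpectrallyNegativeLevy (fun t ω => X t ω + t) P ∧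
    HasLaplaceExponent (fun t ω => X t ω + t) P (fun θ => ψ θ + θ) ∧
    (∃ Wt : ℝ → ℝ, IsScaleFunction (fun θ => ψ θ + θ) Wt) ∧
    -- every spectrally negative Lévy process with exponent `ψˢ` has bounded variation paths, and
    -- the tail of its jump measure is the derivative of the scale function for `ψ(θ) + θ`
    ∀ (Ω' : Type*) [MeasurableSpace Ω'] (P' : Measure Ω') (Y : ℝ≥0 → Ω' → ℝ),
      IsSpectrallyNegativeLevy Y P' → HasLaplaceExponent Y P' (shiftedExponent ψ) →
        HasBoundedVariationPaths Y P' ∧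
        ∀ (μ σ : ℝ) (ν : Measure ℝ), HasLevyTriplet Y P' μ σ ν →
          ∀ Wt : ℝ → ℝ, IsScaleFunction (fun θ => ψ θ + θ) Wt →
            ∀ x, 0 < x → ν (Iio (-x)) < ∞ ∧ HasDerivAt Wt (ν (Iio (-x))).toReal x := by
  have hprob := hX.isLevyProcess.isProbabilityMeasure
  have h0 := hψ.apply_zero
  have hpos : ∀ θ, 0 < θ → 0 < ψ θ := fun θ => hX.exponent_pos hψ hψ'
  obtain ⟨u, hu, hanti, hcont, hlim, hlap⟩ :=
    hW.exists_laplace_density h0 hpos (hX.isLevyProcess.exists_mul_lt_exponent hψ hvar)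
  have hprimitive : IsScaleFunction (fun θ => ψ θ + θ) (primitiveIoi u) :=
    isScaleFunction_primitiveIoi (by rw [h0, add_zero]) (fun θ hθ => add_pos (hpos θ hθ) hθ) hu hlap
  obtain ⟨Ω₀, _, P₀, Y₀, hY₀, hψ₀, μ₀, ν₀, htriplet₀, htail⟩ :=
    exists_isSpectrallyNegativeLevy_shiftedExponent hpos h0 hψ' hu hanti hcont hlim hlap
  refine ⟨⟨Ω₀, _, P₀, Y₀, hY₀, hψ₀⟩, isScaleFunction_shiftedScale hpos hW.1 h0, hX.add_id hvar,
    hψ.add_id, ⟨_, hprimitive⟩, fun Ω' _ P' Y hY hψY => ?_⟩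
  have hle : ∀ θ, 0 < θ → shiftedExponent ψ θ ≤ 1 * θ := fun θ hθ =>
    (shiftedExponent_lt_id hpos hθ).le.trans_eq (one_mul θ).symm
  refine ⟨hY.isLevyProcess.hasBoundedVariationPaths hψY hle, fun μ σ ν htriplet Wt hWt x hx => ?_⟩
  have := hY.isLevyProcess.isProbabilityMeasure
  have := hY₀.isLevyProcess.isProbabilityMeasure
  have hν : ν = ν₀ := htriplet.levyMeasure_eq htriplet₀ <|
    hψY.identDistrib hψ₀ hY.isLevyProcess.measurable hY₀.isLevyProcess.measurable hle
  rw [hν, htail x hx, ENNReal.toReal_ofReal (hu x), hWt.unique hprimitive]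
  exact ⟨ENNReal.ofReal_lt_top, hasDerivAt_primitiveIoi (hlap 1 one_pos).1 hcont hx⟩
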